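/- Let $Q(x,y)=\sum_{i,j=0}^{2} r_{ij}x^iy^j=a(x)y^2+b(x)y+c(x)$ be an irreducible polynomial with complex coefficients (the kernel of a walk with small steps), and write also $\tilde a(y)=\sum_j r_{2j}y^j$, $\tilde c(y)=\sum_j r_{0j}y^j$. Put $D=b^2-4ac=d_4x^4+\dots+d_0$, and assume that the curve $Q=0$ has genus $1$, i.e. that $D$ has degree $3$ or $4$ and only simple roots. Let $\mathbb C_Q(x,y)$ be the field of rational functions on this curve, let $\xi,\eta$ be its automorphisms given by $$\xi(x,y)=\Big(x,\frac{c(x)}{y\,a(x)}\Big),\qquad \eta(x,y)=\Big(\frac{\tilde c(y)}{x\,\tilde a(y)},y\Big),$$ and put $\delta=\eta\xi$; write $h_\alpha=\alpha(h)$. Assume that the group generated by $\xi$ and $\eta$ is finite, of order $2n$ with $n\ge 1$. Let $q,\tilde q,q_0\in\mathbb C_Q(x,y)$ with $q,\tilde q\neq0$, and put $$f=\frac{q\,\tilde q_\eta}{\tilde q\,q_\eta},\qquad \psi=\frac{q_0\,\tilde q_\eta}{q_\eta\,\tilde q}-\frac{(q_0)_\eta}{q_\eta}.$$ Uniformization.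 If $d_4\ne0$, let $x_4$ be a root of $D$. Let $\omega_1,\omega_2$ be $\mathbb R$-linearly independent complex numbers whose Weierstrass function $\wp$ uniformizes the curve, that is, the functions $$x(\omega)=x_4+\frac{D'(x_4)}{\wp(\omega)-\frac16D''(x_4)},\quad u(\omega)=\frac{D'(x_4)\,\wp'(\omega)}{2\big(\wp(\omega)-\frac16D''(x_4)\big)^2}\qquad(d_4\neq0),$$ $$x(\omega)=\frac{\wp(\omega)-\frac{d_2}3}{d_3},\quad u(\omega)=-\frac{\wp'(\omega)}{2d_3}\qquad(d_4=0)$$ satisfy $u(\omega)^2=D(x(\omega))$; put $y(\omega)=\dfrac{u(\omega)-b(x(\omega))}{2a(x(\omega))}$, and for $h\in\mathbb C_Q(x,y)$ write $h(\omega)=h(x(\omega),y(\omega))$. Let $\omega_3$ be a real multiple of $\omega_2$ such that $\delta$ is the translation by $\omega_3$: $h_\delta(\omega)=h(\omega+\omega_3)$ for all $h\in\mathbb C_Q(x,y)$. Let $\zeta(\,\cdot\,;\omega_1,\omega_3)$ be the Weierstrass $\zeta$-function of the lattice $\mathbb Z\omega_1+\mathbb Z\omega_3$, and define functions on $\mathbb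 C$ by $$\widetilde\Phi\Big(\omega+\frac{\omega_2}2\Big)=\frac{\omega_1}{2i\pi}\,\zeta(\omega;\omega_1,\omega_3)-\frac{\omega}{i\pi}\,\zeta\Big(\frac{\omega_1}2;\omega_1,\omega_3\Big),\qquad w_2(\omega)=\frac{\widetilde\Phi(\omega)}n\Big(\sum_{k=0}^{n-1}\frac{\psi_{\delta^k}}{\prod_{i=1}^kf_{\delta^i}}\Big)(\omega).$$ Then $\wp(\omega)=g(x(\omega))$, where $g$ is the fractional linear transform $g(x)=\frac16D''(x_4)+\dfrac{D'(x_4)}{x-x_4}$ if $d_4\neq0$ and $g(x)=d_3x+\frac{d_2}3$ if $d_4=0$; the function $w_2$ is meromorphic on $\mathbb C$; and for all $\omega$ outside a discrete closed subset of $\mathbb C$ there is an analytic branch $\varphi$ of $\wp^{-1}\circ g$ near $x(\omega)$ with $\varphi(x(\omega))=\omega$ and $w_2\circ\varphi$ analytic at $x(\omega)$. The multivalued function $x\mapsto w_2(\wp^{-1}(g(x)))$ is holonomic: there are $m\ge0$ and polynomials $c_0,\dots,c_m\in\mathbb C[x]$ with $c_m\ne0$ such that every branch $F=w_2\circ\varphi$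 of it ($\varphi$ an analytic branch of $\wp^{-1}\circ g$), wherever it is analytic, satisfies $\sum_{i=0}^m c_i(x)F^{(i)}(x)=0$. -/

import Mathlib

open Polynomial Filter Topology

noncomputable section

namespace QuarterPlane

/-! ### The kernel, its discriminant and its function field

The weights of a walk with small steps are recorded by `r : Fin 3 → Fin 3 → ℂ`, where `r i j` is the
coefficient of `x ^ i * y ^ j` in the kernel, that is, up to a common sign, the weight of the step
`(i - 1, j - 1)` (with the constant `1` or `1 / z` taken off for the step `(0, 0)`). -/

/-- `a(x)`, the coefficient of `y ^ 2` in the kernel. -/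
def polyA (r : Fin 3 → Fin 3 → ℂ) : ℂ[X] := ∑ i : Fin 3, C (r i 2) * X ^ (i : ℕ)

/-- `b(x)`, the coefficient of `y` in the kernel. -/
def polyB (r : Fin 3 → Fin 3 → ℂ) : ℂ[X] := ∑ i : Fin 3, C (r i 1) * X ^ (i : ℕ)

/-- `c(x)`, the coefficient of `y ^ 0` in the kernel. -/
def polyC (r : Fin 3 → Fin 3 → ℂ) : ℂ[X] := ∑ i : Fin 3, C (r i 0) * X ^ (i : ℕ)

/-- The coefficient of `x ^ 2` in the kernel, a polynomial in `y`. -/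
def polyA' (r : Fin 3 → Fin 3 → ℂ) : ℂ[X] := ∑ j : Fin 3, C (r 2 j) * X ^ (j : ℕ)

/-- The coefficient of `x ^ 0` in the kernel, a polynomial in `y`. -/
def polyC' (r : Fin 3 → Fin 3 → ℂ) : ℂ[X] := ∑ j : Fin 3, C (r 0 j) * X ^ (j : ℕ)

/-- The kernel `Q(x, y) = a(x) y ^ 2 + b(x) y + c(x)`, an element of `ℂ[x][y]`. -/
def kernel (r : Fin 3 → Fin 3 → ℂ) : ℂ[X][X] :=
  C (polyA r) * X ^ 2 + C (polyB r) * X + C (polyC r)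

/-- The discriminant `D(x) = b(x) ^ 2 - 4 a(x) c(x)`. -/
def disc (r : Fin 3 → Fin 3 → ℂ) : ℂ[X] := polyB r ^ 2 - 4 * polyA r * polyC r

/-- The curve `Q(x, y) = 0` has genus one: as a double cover of the `x`-sphere it has four distinct
branch points, namely the roots of `D`, together with `∞` if `D` has degree three. -/
def GenusOne (r : Fin 3 → Fin 3 → ℂ) : Prop := 3 ≤ (disc r).natDegree ∧ Squarefree (disc r)

/-- The coordinate ring `ℂ[x, y] / (Q)`. -/
abbrev CoordRing (r : Fin 3 → Fin 3 → ℂ) : Type := AdjoinRoot (kernel r)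

/-- The field `ℂ_Q(x, y)` of rational functions on the curve `Q(x, y) = 0`. -/
abbrev FunField (r : Fin 3 → Fin 3 → ℂ) : Type := FractionRing (CoordRing r)

instance coordRing_isDomain (r : Fin 3 → Fin 3 → ℂ) [h : Fact (Irreducible (kernel r))] :
    IsDomain (CoordRing r) :=
  AdjoinRoot.isDomain_of_prime h.out.prime

/-- The class in `ℂ_Q(x, y)` of a polynomial in `x` and `y`. -/
def ofPoly (r : Fin 3 → Fin 3 → ℂ) (P : ℂ[X][X]) : FunField r :=
  algebraMap (CoordRing r) (FunField r) (AdjoinRoot.mk (kernel r) P)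

/-- The coordinate function `x`. -/
def coordX (r : Fin 3 → Fin 3 → ℂ) : FunField r := ofPoly r (C X)

/-- The coordinate function `y`. -/
def coordY (r : Fin 3 → Fin 3 → ℂ) : FunField r := ofPoly r X

/-! ### The group of the walk -/

section Group

variable {r : Fin 3 → Fin 3 → ℂ} [Fact (Irreducible (kernel r))]

/-- `ξ` is the automorphism of `ℂ_Q(x, y)` with `ξ(x, y) = (x, (1 / y) c(x) / a(x))`. -/
def IsXi (ξ : FunField r ≃ₐ[ℂ] FunField r) : Prop :=
  ξ (coordX r) = coordX r ∧
  ξ (coordY r) = 1 / coordY r * (aeval (coordX r) (polyC r) / aeval (coordX r) (polyA r))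

/-- `η` is the automorphism of `ℂ_Q(x, y)` with `η(x, y) = ((1 / x) c'(y) / a'(y), y)`, where `a'`
and `c'` are the coefficients of `x ^ 2` and of `x ^ 0` in `Q`. -/
def IsEta (η : FunField r ≃ₐ[ℂ] FunField r) : Prop :=
  η (coordX r) = 1 / coordX r * (aeval (coordY r) (polyC' r) / aeval (coordY r) (polyA' r)) ∧
  η (coordY r) = coordY r

/-- The group of the walk, generated by `ξ` and `η`. -/
def walkGroup (ξ η : FunField r ≃ₐ[ℂ] FunField r) : Subgroup (FunField r ≃ₐ[ℂ] FunField r) :=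
  Subgroup.closure {ξ, η}

/-- `f = q q̃_η / (q̃ q_η)`. -/
def coeffF (η : FunField r ≃ₐ[ℂ] FunField r) (q q' : FunField r) : FunField r :=
  q * η q' / (q' * η q)

/-- `ψ = q₀ q̃_η / (q_η q̃) - (q₀)_η / q_η`. -/
def coeffPsi (η : FunField r ≃ₐ[ℂ] FunField r) (q q' q₀ : FunField r) : FunField r :=
  q₀ * η q' / (η q * q') - η q₀ / η q

/-- `∑_{k = 0}^{n - 1} ψ_{δ ^ k} / ∏_{i = 1}^k f_{δ ^ i}`. -/
def orbitSum (δ : FunField r ≃ₐ[ℂ] FunField r) (n : ℕ) (f ψ : FunField r) : FunField r :=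
  ∑ k ∈ Finset.range n, (δ ^ k) ψ / ∏ i ∈ Finset.Icc 1 k, (δ ^ i) f

end Group

/-! ### The uniformization of the curve

The parameter `x₄` is a finite branch point; it is used only if `D` has degree four. Otherwise the
fourth branch point is `∞`. -/

/-- The fractional linear transform `g` with `℘(ω) = g(x(ω))`. -/
def g (r : Fin 3 → Fin 3 → ℂ) (x₄ t : ℂ) : ℂ :=
  if (disc r).coeff 4 ≠ 0 then
    (disc r).derivative.derivative.eval x₄ / 6 + (disc r).derivative.eval x₄ / (t - x₄)
  else (disc r).coeff 3 * t + (disc r).coeff 2 / 3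

/-- The function `x(ω)`. -/
def xCov (r : Fin 3 → Fin 3 → ℂ) (x₄ : ℂ) (L : PeriodPair) (ω : ℂ) : ℂ :=
  if (disc r).coeff 4 ≠ 0 then
    x₄ + (disc r).derivative.eval x₄ /
      (L.weierstrassP ω - (disc r).derivative.derivative.eval x₄ / 6)
  else (L.weierstrassP ω - (disc r).coeff 2 / 3) / (disc r).coeff 3

/-- The function `u(ω)`, where `u = 2 a(x) y + b(x)`. -/
def uCov (r : Fin 3 → Fin 3 → ℂ) (x₄ : ℂ) (L : PeriodPair) (ω : ℂ) : ℂ :=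
  if (disc r).coeff 4 ≠ 0 then
    (disc r).derivative.eval x₄ * L.derivWeierstrassP ω /
      (2 * (L.weierstrassP ω - (disc r).derivative.derivative.eval x₄ / 6) ^ 2)
  else - L.derivWeierstrassP ω / (2 * (disc r).coeff 3)

/-- The function `y(ω) = (u(ω) - b(x(ω))) / (2 a(x(ω)))`. -/
def yCov (r : Fin 3 → Fin 3 → ℂ) (x₄ : ℂ) (L : PeriodPair) (ω : ℂ) : ℂ :=
  (uCov r x₄ L ω - (polyB r).eval (xCov r x₄ L ω)) / (2 * (polyA r).eval (xCov r x₄ L ω))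

/-- The pair `L = (ω₁, ω₂)` is a pair of periods of the curve: `x₄` is a branch point (if `D` has
degree four), and the functions `x(ω)` and `u(ω)` formed with the `℘`-function of `L` satisfy
`u ^ 2 = D(x)`, which is `Q(x, y) = 0` multiplied by `4 a(x)`. The identity is asked for wherever
`x(ω)` and `u(ω)` are finite. -/
def IsUniformization (r : Fin 3 → Fin 3 → ℂ) (x₄ : ℂ) (L : PeriodPair) : Prop :=
  ((disc r).coeff 4 ≠ 0 → (disc r).IsRoot x₄) ∧
  ∀ ω : ℂ, ω ∉ L.lattice →
    ((disc r).coeff 4 ≠ 0 → L.weierstrassP ω ≠ (disc r).derivative.derivative.eval x₄ / 6) →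
    uCov r x₄ L ω ^ 2 = (disc r).eval (xCov r x₄ L ω)

/-- The value at `(x(ω), y(ω))` of a rational function `h` on the curve, computed from a numerator
and a denominator of `h`. Another choice of these changes the values on a discrete set only. -/
def onCover {r : Fin 3 → Fin 3 → ℂ} (x₄ : ℂ) (L : PeriodPair) (h : FunField r) (ω : ℂ) : ℂ :=
  let p := IsLocalization.sec (nonZeroDivisors (CoordRing r)) h
  let num : ℂ[X][X] := (AdjoinRoot.mk_surjective p.1).choose
  let den : ℂ[X][X] := (AdjoinRoot.mk_surjective (p.2 : CoordRing r)).choose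
  num.evalEval (xCov r x₄ L ω) (yCov r x₄ L ω) / den.evalEval (xCov r x₄ L ω) (yCov r x₄ L ω)

/-- On the universal covering, `δ` is the translation by `ω₃`: `h_δ(ω) = h(ω + ω₃)` for every
rational function `h` on the curve (outside a discrete set of `ω`, which contains the poles). -/
def IsTranslation {r : Fin 3 → Fin 3 → ℂ} [Fact (Irreducible (kernel r))] (x₄ : ℂ) (L : PeriodPair)
    (δ : FunField r ≃ₐ[ℂ] FunField r) (ω₃ : ℂ) : Prop :=
  ∀ h : FunField r, ∀ᶠ ω in codiscrete ℂ, onCover x₄ L (δ h) ω = onCover x₄ L h (ω + ω₃)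

/-! ### The functions `ζ`, `Φ̃` and `w₂` -/

/-- The Weierstrass function `ζ(ω; ω₁, ω₃)`, which is `1 / ω` plus the sum of
`1 / (ω - l) + 1 / l + ω / l ^ 2` over the nonzero `l` in `ℤ ω₁ + ℤ ω₃`. The term `l = 0` of the sum
below is `1 / ω`, because `1 / 0 = 0`. -/
def weierstrassZeta (ω₁ ω₃ ω : ℂ) : ℂ :=
  ∑' l : Submodule.span ℤ ({ω₁, ω₃} : Set ℂ),
    (1 / (ω - (l : ℂ)) + 1 / (l : ℂ) + ω / (l : ℂ) ^ 2)

/-- The function `Φ̃`, given by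
`Φ̃(ω + ω₂ / 2) = ω₁ / (2 i π) ζ(ω; ω₁, ω₃) - ω / (i π) ζ(ω₁ / 2; ω₁, ω₃)`. -/
def phiTilde (ω₁ ω₂ ω₃ ω : ℂ) : ℂ :=
  ω₁ / (2 * Complex.I * Real.pi) * weierstrassZeta ω₁ ω₃ (ω - ω₂ / 2)
    - (ω - ω₂ / 2) / (Complex.I * Real.pi) * weierstrassZeta ω₁ ω₃ (ω₁ / 2)

/-- `w₂ = (Φ̃ / n) ∑_{k = 0}^{n - 1} ψ_{δ ^ k} / ∏_{i = 1}^k f_{δ ^ i}`, as a function on the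
universal covering, where `δ = η ξ`. -/
def w₂ {r : Fin 3 → Fin 3 → ℂ} [Fact (Irreducible (kernel r))] (x₄ : ℂ) (L : PeriodPair) (ω₃ : ℂ)
    (ξ η : FunField r ≃ₐ[ℂ] FunField r) (n : ℕ) (q q' q₀ : FunField r) (ω : ℂ) : ℂ :=
  phiTilde L.ω₁ L.ω₂ ω₃ ω / n *
    onCover x₄ L (orbitSum (η * ξ) n (coeffF η q q') (coeffPsi η q q' q₀)) ω

/-! ### Holonomic functions -/

/-- A multivalued analytic function of one variable, given by its function elements (`elt F t` says
that `F` is a branch of it near `t`), is holonomic: all its branches satisfy one and the same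
nontrivial linear differential equation with polynomial coefficients. -/
def IsHolonomic (elt : (ℂ → ℂ) → ℂ → Prop) : Prop :=
  ∃ (m : ℕ) (c : ℕ → ℂ[X]), c m ≠ 0 ∧ ∀ (F : ℂ → ℂ) (t : ℂ), elt F t →
    ∑ i ∈ Finset.range (m + 1), (c i).eval t * iteratedDeriv i F t = 0

/-- `φ` is, near `t`, an analytic branch of `℘⁻¹ ∘ g`. -/
def IsInverseBranch (r : Fin 3 → Fin 3 → ℂ) (x₄ : ℂ) (L : PeriodPair) (φ : ℂ → ℂ) (t : ℂ) : Prop :=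
  AnalyticAt ℂ φ t ∧ ∀ᶠ s in 𝓝 t, L.weierstrassP (φ s) = g r x₄ s

/-- The function elements of the multivalued function `x ↦ w(℘⁻¹(g(x)))`: near `t` they are the
functions `w ∘ φ` with `φ` a branch of `℘⁻¹ ∘ g`, wherever these are analytic. -/
def IsBranchOf (r : Fin 3 → Fin 3 → ℂ) (x₄ : ℂ) (L : PeriodPair) (w : ℂ → ℂ)
    (F : ℂ → ℂ) (t : ℂ) : Prop :=
  AnalyticAt ℂ F t ∧ ∃ φ : ℂ → ℂ, IsInverseBranch r x₄ L φ t ∧ F = w ∘ φ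

end QuarterPlane

end

open Polynomial Filter Topology

noncomputable section

namespace QuarterPlane

/-! ### The field of meromorphic functions -/

/-! Finiteness of the group makes `ω₃` commensurable with the periods. Indeed `δ ^ (2 * n) = 1`, so
translation by `2nω₃` fixes `x(ω)`, hence `℘`, and `2nω₃` is a period. As `ω₃ = sω₂` with `s` real,
`2ns` is an integer `j`. It is nonzero: `s = 0` would give `δ = 1`, hence `η(x) = x`, which genus
one excludes (`IsEta.apply_coordX_ne`). So `ℤω₁ + ℤjω₂` lies both in the period lattice of the curve
and in `ℤω₁ + ℤω₃`.

The function `Φ̃` is not elliptic, but since `ζ' = -℘` its derivative is elliptic for `ℤω₁ + ℤω₃`.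
With respect to the common sublattice both `dΦ̃/dx` and `x(ω)` are elliptic, hence algebraically
dependent (`exists_algebraic_relation`), and `dΦ̃/dx` is algebraic over `ℂ(x)`. The orbit sum
matters only as a rational function `S` on the curve, which is algebraic too. Thus `E = ℂ(x)(S,
dΦ̃/dx)` is a finite extension of `ℂ(x)` stable under `d/dx`, and all `x`-derivatives of `SΦ̃` lie
in the finite-dimensional space `E + EΦ̃`. A linear dependence among them is the differential
equation (`exists_linear_ode`).

The algebra takes place in the field of meromorphic functions modulo equality off a discrete closed
set, which absorbs the arbitrary values at poles. A branch of `℘⁻¹ ∘ g` is a local right inverse of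
`x(ω)`, so the chain rule carries the equation to every branch (`ode_of_branch`). -/

lemma eventually_codiscrete_iff {p : ℂ → Prop} :
    (∀ᶠ z in codiscrete ℂ, p z) ↔ ∀ z, ∀ᶠ w in 𝓝[≠] z, p w := by
  rw [Filter.Eventually, mem_codiscrete]
  refine forall_congr' fun z ↦ ?_
  rw [disjoint_principal_right, compl_compl]
  rfl

/-- A meromorphic function on `ℂ` vanishes codiscretely, or is nonzero codiscretely. -/
lemma _root_.Meromorphic.eq_zero_or_ne_zero {f : ℂ → ℂ} (hf : Meromorphic f) :
    (∀ᶠ z in codiscrete ℂ, f z = 0) ∨ ∀ᶠ z in codiscrete ℂ, f z ≠ 0 := by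
  by_cases h : ∃ u, meromorphicOrderAt f u ≠ ⊤
  · right
    rw [eventually_codiscrete_iff]
    intro z
    exact (meromorphicOrderAt_ne_top_iff_eventually_ne_zero (hf z)).1
      (hf.exists_meromorphicOrderAt_ne_top_iff_forall.1 h z)
  · left
    push Not at h
    rw [eventually_codiscrete_iff]
    exact fun z ↦ meromorphicOrderAt_eq_top_iff.1 (h z)

/-- The identity theorem: zeros accumulating at one point force vanishing on the whole plane, up to
a discrete set. -/
lemma eventually_codiscrete_of_frequently {f : ℂ → ℂ} (hf : Meromorphic f) {z : ℂ}
    (h : ∃ᶠ w in 𝓝[≠] z, f w = 0) : ∀ᶠ w in codiscrete ℂ, f w = 0 := by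
  refine hf.eq_zero_or_ne_zero.resolve_right fun h' ↦ h ?_
  exact eventually_codiscrete_iff.1 h' z

lemma eventually_codiscrete_analyticAt {f : ℂ → ℂ} (hf : Meromorphic f) :
    ∀ᶠ z in codiscrete ℂ, AnalyticAt ℂ f z :=
  eventually_codiscrete_iff.2 fun z ↦ (hf z).eventually_analyticAt

lemma eventually_codiscrete_add {p : ℂ → Prop} (h : ∀ᶠ z in codiscrete ℂ, p z) (a : ℂ) :
    ∀ᶠ z in codiscrete ℂ, p (z + a) := by
  rw [eventually_codiscrete_iff] at h ⊢
  intro z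
  refine Tendsto.eventually ?_ (h (z + a))
  refine tendsto_nhdsWithin_iff.2 ⟨(by fun_prop : Continuous fun w : ℂ ↦ w + a).continuousAt.tendsto.mono_left
    nhdsWithin_le_nhds, ?_⟩
  filter_upwards [self_mem_nhdsWithin] with w hw
  simpa using hw

/-- A punctured neighbourhood contains a full neighbourhood of each of its points, so a codiscrete
property may be used locally, for instance to differentiate an identity. -/
lemma eventually_codiscrete_eventually_nhds {p : ℂ → Prop} (h : ∀ᶠ z in codiscrete ℂ, p z) :
    ∀ᶠ z in codiscrete ℂ, ∀ᶠ w in 𝓝 z, p w := by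
  rw [eventually_codiscrete_iff] at h ⊢
  intro z
  filter_upwards [eventually_eventually_nhdsWithin.2 (h z), self_mem_nhdsWithin] with w hw hwz
  rwa [IsOpen.nhdsWithin_eq isOpen_compl_singleton hwz] at hw

/-- This makes differentiation independent of the representative, so that it descends to
`MeroField`. -/
lemma deriv_eventuallyEq {f g : ℂ → ℂ} (h : f =ᶠ[codiscrete ℂ] g) :
    deriv f =ᶠ[codiscrete ℂ] deriv g :=
  (eventually_codiscrete_eventually_nhds h).mono fun _ hz ↦ EventuallyEq.deriv_eq hz

/-- The algebra of meromorphic functions on the complex plane, with all their values. -/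
def meromorphicSubalgebra : Subalgebra ℂ (ℂ → ℂ) where
  carrier := {f | Meromorphic f}
  mul_mem' hf hg := Meromorphic.mul hf hg
  add_mem' hf hg := Meromorphic.add hf hg
  algebraMap_mem' c := Meromorphic.const c

/-- The ideal of the meromorphic functions that vanish outside a discrete set. -/
def nullIdeal : Ideal meromorphicSubalgebra where
  carrier := {f | ∀ᶠ z in codiscrete ℂ, f.1 z = 0}
  zero_mem' := by simp
  add_mem' := by
    intro f g hf hg
    rw [Set.mem_ofPred] at hf hg ⊢
    refine (hf.and hg).mono fun z h ↦ ?_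
    simp [h.1, h.2]
  smul_mem' := by
    intro f g hg
    rw [Set.mem_ofPred] at hg ⊢
    refine Eventually.mono hg fun z h ↦ ?_
    simp [h]

instance : nullIdeal.IsMaximal := by
  have hbot : (codiscrete ℂ).NeBot := by
    rw [neBot_iff]
    intro h
    have : ∀ᶠ z in codiscrete ℂ, False := by rw [h]; trivial
    exact (eventually_codiscrete_iff.1 this 0).exists.elim fun _ h ↦ h
  refine Ideal.isMaximal_iff.2 ⟨fun h ↦ ?_, fun J f hJ hf hfJ ↦ ?_⟩
  · have h1 : ∀ᶠ z in codiscrete ℂ, (1 : ℂ) = 0 := h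
    simpa using h1.exists
  · have hf0 : ∀ᶠ z in codiscrete ℂ, f.1 z ≠ 0 :=
      (Meromorphic.eq_zero_or_ne_zero f.2).resolve_left hf
    let g : meromorphicSubalgebra := ⟨f.1⁻¹, Meromorphic.inv f.2⟩
    have h1 : (1 - g * f) ∈ J := hJ <| by
      change ∀ᶠ z in codiscrete ℂ, (1 - (f.1 z)⁻¹ * f.1 z) = 0
      filter_upwards [hf0] with z hz
      simp [hz]
    have := J.add_mem h1 (J.mul_mem_left g hfJ)
    simpa using this

/-- The field of meromorphic functions on the complex plane. -/
def MeroField : Type := meromorphicSubalgebra ⧸ nullIdeal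

instance meroFieldInst : Field MeroField := Ideal.Quotient.field nullIdeal

/-- The quotient homomorphism onto the field of meromorphic functions, as a ring homomorphism. -/
def MeroField.mkRingHom : meromorphicSubalgebra →+* MeroField := Ideal.Quotient.mk nullIdeal

lemma MeroField.mkRingHom_surjective : Function.Surjective mkRingHom :=
  Ideal.Quotient.mk_surjective

lemma MeroField.mkRingHom_eq_iff {f g : meromorphicSubalgebra} :
    mkRingHom f = mkRingHom g ↔ ∀ᶠ z in codiscrete ℂ, f.1 z - g.1 z = 0 :=
  Ideal.Quotient.eq

attribute [irreducible] meroFieldInst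

instance : Algebra ℂ MeroField :=
  (MeroField.mkRingHom.comp (algebraMap ℂ meromorphicSubalgebra)).toAlgebra

instance : CharZero MeroField :=
  charZero_of_injective_algebraMap (algebraMap ℂ MeroField).injective

/-- The quotient homomorphism onto the field of meromorphic functions. -/
def MeroField.mkHom : meromorphicSubalgebra →ₐ[ℂ] MeroField :=
  { MeroField.mkRingHom with commutes' := fun _ ↦ rfl }

/-- The element of the field of meromorphic functions given by a function. -/
def MeroField.mk (f : ℂ → ℂ) (hf : Meromorphic f) : MeroField :=
  mkHom ⟨f, hf⟩

namespace MeroField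

lemma mk_surjective (F : MeroField) : ∃ f hf, F = mk f hf := by
  obtain ⟨f, rfl⟩ := mkRingHom_surjective F
  exact ⟨f.1, f.2, rfl⟩

lemma mk_eq_mk {f g : ℂ → ℂ} {hf : Meromorphic f} {hg : Meromorphic g} :
    mk f hf = mk g hg ↔ f =ᶠ[codiscrete ℂ] g :=
  mkRingHom_eq_iff.trans (by simp [sub_eq_zero, EventuallyEq])

lemma mk_zero : mk (fun _ ↦ 0) (Meromorphic.const 0) = 0 := map_zero mkHom

lemma mk_add {f g : ℂ → ℂ} (hf : Meromorphic f) (hg : Meromorphic g) :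
    mk (f + g) (hf.add hg) = mk f hf + mk g hg := map_add mkHom ⟨f, hf⟩ ⟨g, hg⟩

lemma mk_mul {f g : ℂ → ℂ} (hf : Meromorphic f) (hg : Meromorphic g) :
    mk (f * g) (hf.mul hg) = mk f hf * mk g hg := map_mul mkHom ⟨f, hf⟩ ⟨g, hg⟩

lemma mk_const (c : ℂ) : mk (fun _ ↦ c) (Meromorphic.const c) = algebraMap ℂ MeroField c := rfl

lemma mk_eq_zero {f : ℂ → ℂ} {hf : Meromorphic f} :
    mk f hf = 0 ↔ ∀ᶠ z in codiscrete ℂ, f z = 0 := by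
  rw [← mk_zero, mk_eq_mk]; rfl

lemma mk_sum {ι : Type*} (s : Finset ι) {f : ι → ℂ → ℂ} (hf : ∀ i, Meromorphic (f i)) :
    mk (fun z ↦ ∑ i ∈ s, f i z) (Meromorphic.fun_sum fun i _ ↦ hf i) = ∑ i ∈ s, mk (f i) (hf i) := by
  classical
  induction s using Finset.induction_on with
  | empty => simp [← mk_zero]
  | insert a s ha ih =>
    rw [Finset.sum_insert ha, ← ih, ← mk_add]
    congr 1
    ext z
    simp [Finset.sum_insert ha]

lemma mk_pow {f : ℂ → ℂ} (hf : Meromorphic f) (n : ℕ) :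
    mk (f ^ n) (hf.pow) = mk f hf ^ n := map_pow mkHom ⟨f, hf⟩ n

lemma mk_inv {f : ℂ → ℂ} (hf : Meromorphic f) : mk f⁻¹ hf.inv = (mk f hf)⁻¹ := by
  rcases hf.eq_zero_or_ne_zero with h | h
  · rw [mk_eq_zero.2 h, inv_zero, mk_eq_zero]
    filter_upwards [h] with z hz
    simp [hz]
  · have h0 : mk f hf ≠ 0 := by
      rw [Ne, mk_eq_zero]
      intro h'
      obtain ⟨w, h1, h2⟩ := ((eventually_codiscrete_iff.1 h 0).and
        (eventually_codiscrete_iff.1 h' 0)).exists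
      exact h1 h2
    rw [← mul_left_inj' h0, inv_mul_cancel₀ h0, ← mk_mul, ← map_one (algebraMap ℂ MeroField), ← mk_const,
      mk_eq_mk]
    filter_upwards [h] with z hz
    simp [hz]

lemma mk_div {f g : ℂ → ℂ} (hf : Meromorphic f) (hg : Meromorphic g) :
    mk (f / g) (hf.div hg) = mk f hf / mk g hg := by
  rw [div_eq_mul_inv (mk f hf), ← mk_inv, ← mk_mul, mk_eq_mk, div_eq_mul_inv]

lemma meromorphic_eval (P : ℂ[X]) {f : ℂ → ℂ} (hf : Meromorphic f) :
    Meromorphic fun z ↦ P.eval (f z) := by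
  induction P using Polynomial.induction_on' with
  | add p q hp hq => simpa using! hp.add hq
  | monomial n a => simpa using! (Meromorphic.const a).mul (hf.pow (n := n))

lemma mk_eval (P : ℂ[X]) {f : ℂ → ℂ} (hf : Meromorphic f) :
    mk (fun z ↦ P.eval (f z)) (meromorphic_eval P hf) = aeval (mk f hf) P := by
  change mkHom _ = aeval (mkHom _) P
  rw [aeval_algHom_apply]
  congr 1
  apply Subtype.ext
  funext z
  have := Polynomial.aeval_algHom_apply (((Pi.evalAlgHom ℂ (fun _ : ℂ ↦ ℂ) z)).comp
    meromorphicSubalgebra.val) ⟨f, hf⟩ P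
  change P.eval (f z) = _
  rw [← Polynomial.coe_aeval_eq_eval]
  exact this

/-- The derivative of a meromorphic function, as a map on the field of meromorphic functions. -/
def derivFun (F : MeroField) : MeroField :=
  mk (deriv F.mk_surjective.choose) F.mk_surjective.choose_spec.choose.deriv

lemma derivFun_mk {f : ℂ → ℂ} (hf : Meromorphic f) : derivFun (mk f hf) = mk (deriv f) hf.deriv := by
  rw [derivFun, mk_eq_mk]
  apply deriv_eventuallyEq
  rw [← mk_eq_mk (hg := hf)]
  exact (mk f hf).mk_surjective.choose_spec.choose_spec.symm

/-- The derivation `d / dω` of the field of meromorphic functions. -/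
def D : Derivation ℂ MeroField MeroField :=
  Derivation.mk'
    { toFun := derivFun
      map_add' := by
        intro F G
        obtain ⟨f, hf, rfl⟩ := F.mk_surjective
        obtain ⟨g, hg, rfl⟩ := G.mk_surjective
        rw [← mk_add, derivFun_mk, derivFun_mk, derivFun_mk, ← mk_add, mk_eq_mk]
        filter_upwards [eventually_codiscrete_analyticAt hf, eventually_codiscrete_analyticAt hg]
          with z h1 h2
        exact deriv_add h1.differentiableAt h2.differentiableAt
      map_smul' := by
        intro c F
        obtain ⟨f, hf, rfl⟩ := F.mk_surjective
        rw [RingHom.id_apply, Algebra.smul_def, Algebra.smul_def, ← mk_const, ← mk_mul, derivFun_mk,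
          derivFun_mk, ← mk_mul, mk_eq_mk]
        filter_upwards [eventually_codiscrete_analyticAt hf] with z h1
        exact deriv_const_mul c h1.differentiableAt }
    (by
      intro F G
      obtain ⟨f, hf, rfl⟩ := F.mk_surjective
      obtain ⟨g, hg, rfl⟩ := G.mk_surjective
      change derivFun _ = mk f hf * derivFun _ + mk g hg * derivFun _
      rw [← mk_mul, derivFun_mk, derivFun_mk, derivFun_mk, ← mk_mul, ← mk_mul, ← mk_add, mk_eq_mk]
      filter_upwards [eventually_codiscrete_analyticAt hf, eventually_codiscrete_analyticAt hg]
        with z h1 h2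
      rw [deriv_mul h1.differentiableAt h2.differentiableAt]
      simp only [Pi.add_apply, Pi.mul_apply]
      ring)

lemma D_mk {f : ℂ → ℂ} (hf : Meromorphic f) : D (mk f hf) = mk (deriv f) hf.deriv :=
  derivFun_mk hf

end MeroField

/-! ### Algebraic dependence of elliptic functions -/

lemma exists_add_lattice_norm_le (L : PeriodPair) : ∃ R : ℝ, ∀ z : ℂ, ∃ l ∈ L.lattice, ‖z + l‖ ≤ R := by
  obtain ⟨R, hR⟩ := (ZSpan.fundamentalDomain_isBounded L.basis).exists_norm_le
  refine ⟨R, fun z ↦ ⟨-(ZSpan.floor L.basis z : ℂ), ?_, ?_⟩⟩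
  · rw [L.lattice_eq_span_range_basis]
    exact neg_mem (ZSpan.floor L.basis z).2
  · rw [← sub_eq_add_neg]
    exact hR _ (ZSpan.fract_mem_fundamentalDomain L.basis z)

/-- An entire doubly periodic function is constant. -/
lemma eq_of_entire_of_periodic (L : PeriodPair) {f : ℂ → ℂ} (hf : Differentiable ℂ f)
    (hper : ∀ l ∈ L.lattice, ∀ z, f (z + l) = f z) (z w : ℂ) : f z = f w := by
  refine hf.apply_eq_apply_of_bounded ?_ z w
  obtain ⟨R, hR⟩ := exists_add_lattice_norm_le L
  refine ((isCompact_closedBall (0 : ℂ) R).image hf.continuous).isBounded.subset ?_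
  rintro _ ⟨z, rfl⟩
  obtain ⟨l, hl, h⟩ := hR z
  exact ⟨z + l, by simpa using h, hper l hl z⟩

/-- A doubly periodic meromorphic function without poles is constant. -/
lemma exists_eq_const_of_periodic (L : PeriodPair) {f : ℂ → ℂ}
    (hper : ∀ l ∈ L.lattice, ∀ z, f (z + l) = f z)
    (hf : ∀ z, ∃ G, AnalyticAt ℂ G z ∧ f =ᶠ[𝓝[≠] z] G) :
    ∃ c, ∀ᶠ z in codiscrete ℂ, f z = c := by
  choose G hG hfG using hf
  have hmer : Meromorphic f := fun z ↦ (hG z).meromorphicAt.congr (hfG z).symm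
  set H : ℂ → ℂ := fun z ↦ G z z with hH
  -- The local extensions glue: at `w` near `z`, both `G w w` and `G z w` are the limit of `f` at
  -- `w`.
  have hHG (z : ℂ) : H =ᶠ[𝓝 z] G z := by
    rw [← nhdsNE_sup_pure]
    refine eventually_sup.2 ⟨?_, rfl⟩
    filter_upwards [eventually_eventually_nhdsWithin.2 (hfG z), self_mem_nhdsWithin,
      (hG z).eventually_analyticAt.filter_mono nhdsWithin_le_nhds] with w h1 hwz h2
    rw [IsOpen.nhdsWithin_eq isOpen_compl_singleton hwz] at h1
    refine tendsto_nhds_unique (f := f) (l := 𝓝[≠] w) ?_ ?_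
    · exact ((hG w).continuousAt.tendsto.mono_left nhdsWithin_le_nhds).congr' (hfG w).symm
    · have h3 : f =ᶠ[𝓝[≠] w] G z := h1.filter_mono nhdsWithin_le_nhds
      exact (h2.continuousAt.tendsto.mono_left nhdsWithin_le_nhds).congr' h3.symm
  have hdiff : Differentiable ℂ H := fun z ↦ ((hG z).congr (hHG z).symm).differentiableAt
  have hfH (z : ℂ) : f =ᶠ[𝓝[≠] z] H := (hfG z).trans ((hHG z).filter_mono nhdsWithin_le_nhds).symm
  have hcod : f =ᶠ[codiscrete ℂ] H := eventually_codiscrete_iff.2 hfH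
  refine ⟨H 0, ?_⟩
  filter_upwards [hcod] with z hz
  rw [hz]
  refine eq_of_entire_of_periodic L hdiff (fun l hl z ↦ ?_) z 0
  have h1 : Tendsto f (𝓝[≠] z) (𝓝 (H z)) :=
    (hdiff.continuous.continuousAt.tendsto.mono_left nhdsWithin_le_nhds).congr' (hfH z).symm
  have h2 : Tendsto f (𝓝[≠] z) (𝓝 (H (z + l))) := by
    refine Tendsto.congr' (f₁ := fun w ↦ H (w + l)) ?_ ?_
    · filter_upwards [eventually_codiscrete_iff.1 (eventually_codiscrete_add hcod l) z] with w hw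
      rw [← hw, hper l hl]
    · exact ((hdiff.continuous.comp (continuous_add_const l)).continuousAt.tendsto.mono_left
        nhdsWithin_le_nhds)
  exact tendsto_nhds_unique h2 h1

/-- Sufficiently many functions with poles of bounded order at the points of a finite set have a
nontrivial linear combination without poles in this set. -/
lemma exists_combination_without_poles {ι : Type*} [Fintype ι] (Z : Finset ℂ) (M : ℕ)
    (F : ι → ℂ → ℂ) (hF : ∀ z ∈ Z, ∀ i, AnalyticAt ℂ (fun w ↦ (w - z) ^ M * F i w) z) (e : ι)
    (hcard : Z.card * M + 1 < Fintype.card ι) :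
    ∃ c : ι → ℂ, c ≠ 0 ∧ c e = 0 ∧ ∀ z ∈ Z, ∃ G, AnalyticAt ℂ G z ∧
      (fun w ↦ ∑ i, c i * F i w) =ᶠ[𝓝[≠] z] G := by
  -- The linear conditions on `c`: `c e = 0`, and at each `z ∈ Z` the derivatives of order below `M`
  -- of `(w - z) ^ M * ∑ c i * F i w` vanish. These are `|Z| * M + 1` equations, fewer than the
  -- unknowns.
  let T : (ι → ℂ) →ₗ[ℂ] (Option (Z × Fin M) → ℂ) := LinearMap.pi fun o ↦ match o with
    | none => LinearMap.proj e
    | some p => ∑ i, (iteratedDeriv p.2 (fun w ↦ (w - p.1.1) ^ M * F i w) p.1.1) •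
        LinearMap.proj i
  have hT : LinearMap.ker T ≠ ⊥ := by
    apply LinearMap.ker_ne_bot_of_finrank_lt
    simpa using hcard
  obtain ⟨c, hc, hc0⟩ := (Submodule.ne_bot_iff _).1 hT
  have hTc (o) : T c o = 0 := by rw [LinearMap.mem_ker.1 hc]; rfl
  refine ⟨c, hc0, hTc none, fun z hz ↦ ?_⟩
  set G : ℂ → ℂ := fun w ↦ ∑ i, c i * ((w - z) ^ M * F i w) with hGdef
  have hG : AnalyticAt ℂ G z := Finset.analyticAt_fun_sum _ fun i _ ↦ analyticAt_const.mul (hF z hz i)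
  have hord : (M : ℕ∞) ≤ analyticOrderAt G z := by
    rw [natCast_le_analyticOrderAt_iff_iteratedDeriv_eq_zero hG]
    intro k hk
    have h := hTc (some (⟨z, hz⟩, ⟨k, hk⟩))
    rw [hGdef, iteratedDeriv_fun_sum]
    · rw [← h]
      simp only [T, LinearMap.pi_apply, LinearMap.sum_apply, LinearMap.smul_apply,
        LinearMap.proj_apply, smul_eq_mul]
      refine Finset.sum_congr rfl fun i _ ↦ ?_
      rw [iteratedDeriv_const_mul_field, mul_comm]
    · intro i _
      exact (analyticAt_const.mul (hF z hz i)).contDiffAt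
  obtain ⟨H, hH, hGH⟩ := (natCast_le_analyticOrderAt hG).1 hord
  refine ⟨H, hH, ?_⟩
  filter_upwards [hGH.filter_mono nhdsWithin_le_nhds, self_mem_nhdsWithin] with w hw hwz
  have h0 : (w - z) ^ M ≠ 0 := pow_ne_zero _ (sub_ne_zero.2 hwz)
  rw [← mul_right_inj' h0, ← smul_eq_mul, ← smul_eq_mul, ← hw, hGdef, smul_eq_mul, Finset.mul_sum]
  exact Finset.sum_congr rfl fun i _ ↦ by ring

/-- Two elliptic functions with the same periods are algebraically dependent. -/
theorem exists_algebraic_relation (L : PeriodPair) {f g : ℂ → ℂ} (hf : Meromorphic f)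
    (hg : Meromorphic g) (hfper : ∀ l ∈ L.lattice, ∀ z, f (z + l) = f z)
    (hgper : ∀ l ∈ L.lattice, ∀ z, g (z + l) = g z) :
    ∃ (m : ℕ) (c : Fin m × Fin m → ℂ), c ≠ 0 ∧
      ∀ᶠ z in codiscrete ℂ, ∑ p, c p * (f z ^ (p.1 : ℕ) * g z ^ (p.2 : ℕ)) = 0 := by
  classical
  obtain ⟨R, hR⟩ := exists_add_lattice_norm_le L
  have hfin : {z : ℂ | z ∈ Metric.closedBall 0 R ∧ ¬ (AnalyticAt ℂ f z ∧ AnalyticAt ℂ g z)}.Finite := by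
    have hK : {z | AnalyticAt ℂ f z ∧ AnalyticAt ℂ g z} ∈
        codiscreteWithin (Metric.closedBall (0 : ℂ) R) :=
      inter_mem hf.meromorphicOn.analyticAt_mem_codiscreteWithin
        hg.meromorphicOn.analyticAt_mem_codiscreteWithin
    exact (isCompact_closedBall (0 : ℂ) R).finite_sdiff_of_mem_codiscreteWithin hK
  set Z := hfin.toFinset with hZ
  choose Nf hNf using hf
  choose Ng hNg using hg
  set N := ∑ z ∈ Z, (Nf z + Ng z) with hN
  have hle (z) (hz : z ∈ Z) : Nf z ≤ N ∧ Ng z ≤ N := by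
    have := Finset.single_le_sum (f := fun z ↦ Nf z + Ng z) (fun _ _ ↦ Nat.zero_le _) hz
    constructor <;> omega
  have hpow {h : ℂ → ℂ} {z : ℂ} {a : ℕ} (ha : AnalyticAt ℂ (fun w ↦ (w - z) ^ a • h w) z) (i b : ℕ)
      (hb : a * i ≤ b) : AnalyticAt ℂ (fun w ↦ (w - z) ^ b * h w ^ i) z := by
    have h1 : (fun w ↦ (w - z) ^ b * h w ^ i) =
        fun w ↦ (w - z) ^ (b - a * i) * ((w - z) ^ a • h w) ^ i := by
      funext w
      rw [smul_eq_mul, mul_pow, ← mul_assoc, ← pow_mul, ← pow_add, Nat.sub_add_cancel hb]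
    rw [h1]
    fun_prop
  -- Monomials with exponents at most `m` have poles of order at most `2Nm` on `Z`. The number of
  -- conditions is `|Z| * 2Nm + 1 = (m - 1)m + 1`, less than the number `(m + 1) ^ 2` of monomials.
  set m := 2 * N * Z.card + 1 with hm
  set F : Fin (m + 1) × Fin (m + 1) → ℂ → ℂ := fun p w ↦ f w ^ (p.1 : ℕ) * g w ^ (p.2 : ℕ) with hF
  obtain ⟨c, hc, hc0, hcZ⟩ := exists_combination_without_poles Z (2 * N * m) F
    (by
      intro z hz p
      have h1 := hpow (hNf z) p.1 (N * m) (Nat.mul_le_mul (hle z hz).1 (by omega))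
      have h2 := hpow (hNg z) p.2 (N * m) (Nat.mul_le_mul (hle z hz).2 (by omega))
      refine (h1.mul h2).congr (Eventually.of_forall fun w ↦ ?_)
      simp only [hF, Pi.mul_apply]
      ring) (0, 0)
    (by
      simp only [Fintype.card_prod, Fintype.card_fin]
      nlinarith [hm])
  -- Periods move any point into the ball of radius `R`, where all poles lie in `Z` and have been
  -- cancelled.
  obtain ⟨κ, hκ⟩ := exists_eq_const_of_periodic L (f := fun w ↦ ∑ p, c p * F p w)
    (by
      intro l hl z
      simp only [hF, hfper l hl, hgper l hl])
    (by
      intro z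
      obtain ⟨l, hl, hzl⟩ := hR z
      obtain ⟨G, hG, hGF⟩ : ∃ G, AnalyticAt ℂ G (z + l) ∧
          (fun w ↦ ∑ p, c p * F p w) =ᶠ[𝓝[≠] (z + l)] G := by
        by_cases hzZ : z + l ∈ Z
        · exact hcZ _ hzZ
        · have : AnalyticAt ℂ f (z + l) ∧ AnalyticAt ℂ g (z + l) := by
            by_contra h
            exact hzZ (hfin.mem_toFinset.2 ⟨by simpa using hzl, h⟩)
          obtain ⟨h1, h2⟩ := this
          refine ⟨_, ?_, EventuallyEq.rfl⟩
          refine Finset.analyticAt_fun_sum _ fun p _ ↦ ?_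
          simp only [hF]
          fun_prop
      refine ⟨fun w ↦ G (w + l), hG.comp_of_eq (by fun_prop) rfl, ?_⟩
      have ht : Tendsto (fun w ↦ w + l) (𝓝[≠] z) (𝓝[≠] (z + l)) := by
        refine tendsto_nhdsWithin_iff.2 ⟨(continuous_add_const l).continuousAt.tendsto.mono_left
          nhdsWithin_le_nhds, ?_⟩
        filter_upwards [self_mem_nhdsWithin] with w hw
        simpa using hw
      filter_upwards [ht.eventually hGF] with w hw
      rw [← hw]
      simp only [hF, hfper l hl, hgper l hl])
  -- The monomial of index `(0, 0)` is `1`. Since `c (0, 0) = 0`, changing this one coefficient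
  -- cannot annihilate `c`.
  refine ⟨m + 1, c - Pi.single (0, 0) κ, fun h ↦ hc ?_, ?_⟩
  · funext p
    have := congrFun h p
    by_cases hp : p = (0, 0)
    · rw [hp, hc0]; rfl
    · simpa [Pi.single_eq_of_ne hp] using this
  · filter_upwards [hκ] with z hz
    simp only [Pi.sub_apply, sub_mul, Finset.sum_sub_distrib]
    rw [hz, Finset.sum_eq_single (0, 0)]
    · simp
    · intro p _ hp
      simp [Pi.single_eq_of_ne hp]
    · simp

/-! ### Linear differential equations over `ℂ(x)` -/

section Algebraic

variable {F K : Type*} [Field F] [Field K] [Algebra F K] {x : K}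

/-- A derivation with `D x = 1` maps `F(x)` to itself. -/
lemma derivation_mem_adjoin_simple (D : Derivation F K K) (hx : D x = 1) {a : K}
    (ha : a ∈ IntermediateField.adjoin F {x}) : D a ∈ IntermediateField.adjoin F {x} := by
  induction ha using IntermediateField.adjoin_induction with
  | mem y hy =>
    rw [Set.mem_singleton_iff.1 hy, hx]
    exact one_mem _
  | algebraMap c => simp
  | add a b _ _ ha hb => simpa using add_mem ha hb
  | inv a h ha =>
    rw [Derivation.leibniz_inv]
    exact mul_mem (neg_mem (pow_mem (inv_mem h) 2)) ha
  | mul a b h1 h2 ha hb =>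
    rw [Derivation.leibniz]
    exact add_mem (mul_mem h1 hb) (mul_mem h2 ha)

/-- The chain rule: `e` is the value at `a` of the polynomial obtained by applying `D` to the
coefficients of `p`. -/
lemma exists_derivation_aeval_eq (D : Derivation F K K)
    (k : IntermediateField F K) (hk : ∀ a ∈ k, D a ∈ k) (E : IntermediateField k K)
    {a : K} (ha : a ∈ E) (p : k[X]) :
    ∃ e ∈ E, D (aeval a p) = e + aeval a (derivative p) * D a := by
  induction p using Polynomial.induction_on' with
  | add p q hp hq =>
    obtain ⟨e, he, h1⟩ := hp
    obtain ⟨e', he', h2⟩ := hq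
    refine ⟨e + e', add_mem he he', ?_⟩
    simp only [map_add, h1, h2]
    ring
  | monomial n c =>
    refine ⟨a ^ n * D (c : K), mul_mem (pow_mem ha n) (E.algebraMap_mem ⟨_, hk _ c.2⟩), ?_⟩
    rw [aeval_monomial, derivative_monomial, aeval_monomial, Derivation.leibniz,
      Derivation.leibniz_pow]
    simp only [smul_eq_mul, nsmul_eq_mul, map_mul, map_natCast, IntermediateField.algebraMap_apply]
    ring

/-- In characteristic zero, a derivation that maps a field to itself maps its algebraic extensions
to themselves. -/
lemma derivation_mem_of_isAlgebraic [CharZero K] (D : Derivation F K K)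
    (k : IntermediateField F K) (hk : ∀ a ∈ k, D a ∈ k) (E : IntermediateField k K)
    {a : K} (ha : a ∈ E) (halg : IsAlgebraic k a) : D a ∈ E := by
  have hint := halg.isIntegral
  have : CharZero k := (algebraMap k K).charZero
  set p := minpoly k a with hp
  have hp0 : aeval a (derivative p) ≠ 0 :=
    (minpoly.irreducible hint).separable.aeval_derivative_ne_zero (minpoly.aeval k a)
  -- Differentiating `p(a) = 0` gives `0 = e + p'(a) * D a`, which separability of `p` allows to be
  -- solved for `D a`.
  obtain ⟨e, he, h1⟩ := exists_derivation_aeval_eq D k hk E ha p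
  rw [hp, minpoly.aeval, map_zero, ← hp] at h1
  have h2 : D a = - e / aeval a (derivative p) := by
    field_simp
    linear_combination -h1
  rw [h2]
  refine div_mem (neg_mem he) ?_
  rw [aeval_eq_sum_range]
  exact sum_mem fun i _ ↦ E.smul_mem (pow_mem ha i)

/-- Finitely many elements of `F(x)` have a common denominator. -/
lemma exists_common_denominator {ι : Type*} (s : Finset ι) (c : ι → K)
    (hc : ∀ i ∈ s, c i ∈ IntermediateField.adjoin F {x}) :
    ∃ d : F[X], aeval x d ≠ 0 ∧ ∀ i ∈ s, ∃ p : F[X], c i * aeval x d = aeval x p := by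
  classical
  induction s using Finset.induction_on with
  | empty => exact ⟨1, by simp, by simp⟩
  | insert a s ha ih =>
    obtain ⟨d, hd, h⟩ := ih fun i hi ↦ hc i (Finset.mem_insert_of_mem hi)
    obtain ⟨u, v, huv⟩ := (IntermediateField.mem_adjoin_simple_iff _ _).1
      (hc a (Finset.mem_insert_self a s))
    by_cases hv : aeval x v = 0
    -- Here the new element is a quotient by zero, hence `0`, and the old denominator still works.
    · refine ⟨d, hd, fun i hi ↦ ?_⟩
      rcases Finset.mem_insert.1 hi with rfl | hi
      · exact ⟨0, by simp [huv, hv]⟩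
      · exact h i hi
    · refine ⟨d * v, by simp [hd, hv], fun i hi ↦ ?_⟩
      rcases Finset.mem_insert.1 hi with rfl | hi
      · refine ⟨d * u, ?_⟩
        rw [huv, map_mul, map_mul]
        field_simp
      · obtain ⟨p, hp⟩ := h i hi
        exact ⟨p * v, by rw [map_mul, map_mul, ← hp, mul_assoc]⟩

/-- Cutting a nontrivial relation off at its last nonzero coefficient gives an equation whose
leading coefficient is nonzero. -/
lemma exists_leading_coefficient {R M : Type*} [Semiring R] [AddCommMonoid M] (A : R → ℕ → M)
    (hA : ∀ i, A 0 i = 0) (N : ℕ) (c : ℕ → R) (hc : ∃ i ≤ N, c i ≠ 0)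
    (h : ∑ i ∈ Finset.range (N + 1), A (c i) i = 0) :
    ∃ m, c m ≠ 0 ∧ ∑ i ∈ Finset.range (m + 1), A (c i) i = 0 := by
  induction N with
  | zero =>
    obtain ⟨i, hi, h0⟩ := hc
    obtain rfl : i = 0 := by omega
    exact ⟨0, h0, h⟩
  | succ N ih =>
    by_cases hN : c (N + 1) = 0
    · refine ih ?_ ?_
      · obtain ⟨i, hi, h0⟩ := hc
        refine ⟨i, ?_, h0⟩
        rcases Nat.lt_or_eq_of_le hi with h1 | rfl
        · omega
        · exact absurd hN h0
      · rwa [Finset.sum_range_succ, hN, hA, add_zero] at h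
    · exact ⟨N + 1, hN, h⟩

/-- If `S` and `D Φ` are algebraic over `F(x)`, where `D x = 1`, then `S Φ` satisfies a linear
differential equation with coefficients in `F[x]`. -/
theorem exists_linear_ode [CharZero K] (D : Derivation F K K) (hx : D x = 1) {S Φ : K}
    (hS : IsAlgebraic (IntermediateField.adjoin F {x}) S)
    (hΦ : IsAlgebraic (IntermediateField.adjoin F {x}) (D Φ)) :
    ∃ (m : ℕ) (c : ℕ → F[X]), c m ≠ 0 ∧
      ∑ i ∈ Finset.range (m + 1), aeval x (c i) * D^[i] (S * Φ) = 0 := by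
  classical
  set k := IntermediateField.adjoin F {x} with hk
  have hDk : ∀ a ∈ k, D a ∈ k := fun a ha ↦ derivation_mem_adjoin_simple D hx ha
  let E : IntermediateField k K := IntermediateField.adjoin k {S, D Φ}
  have hE : FiniteDimensional k E := by
    apply IntermediateField.finiteDimensional_adjoin
    rintro a (rfl | rfl)
    · exact hS.isIntegral
    · exact hΦ.isIntegral
  have hDE : ∀ a ∈ E, D a ∈ E := fun a ha ↦ by
    refine derivation_mem_of_isAlgebraic D k hDk E ha ?_
    have := (Algebra.IsAlgebraic.isAlgebraic (R := k) (⟨a, ha⟩ : E))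
    exact this.algebraMap (A := K)
  -- The range of `f` is `E + EΦ`, of finite dimension over `k`. It is stable under `D` because `D
  -- (a + bΦ) = (D a + b * D Φ) + (D b)Φ`.
  let f : E × E →ₗ[k] K :=
    { toFun := fun p ↦ (p.1 : K) + p.2 * Φ
      map_add' := fun p q ↦ by simp; ring
      map_smul' := fun c p ↦ by simp [Algebra.smul_def]; ring }
  have hV : ∀ i, D^[i] (S * Φ) ∈ LinearMap.range f := by
    intro i
    induction i with
    | zero =>
      exact ⟨(0, ⟨S, IntermediateField.subset_adjoin _ _ (by simp)⟩), by simp [f]⟩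
    | succ i ih =>
      obtain ⟨⟨a, b⟩, hab⟩ := ih
      rw [Function.iterate_succ_apply', ← hab]
      refine ⟨(⟨D a + b * D Φ, ?_⟩, ⟨D b, hDE _ b.2⟩), ?_⟩
      · exact add_mem (hDE _ a.2) (mul_mem b.2 (IntermediateField.subset_adjoin _ _ (by simp)))
      · simp [f]
        ring
  let v : ℕ → LinearMap.range f := fun i ↦ ⟨_, hV i⟩
  set N := Module.finrank k (LinearMap.range f)
  obtain ⟨g, hg, i₀, hi₀, hgi⟩ : ∃ g : Fin (N + 1) → k, ∑ i, g i • v i = 0 ∧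
      ∃ i, i ∈ Finset.univ ∧ g i ≠ 0 := by
    have hv : ¬ LinearIndependent k fun i : Fin (N + 1) ↦ v i := fun h ↦ by
      simpa [N] using h.fintype_card_le_finrank
    simpa using Fintype.not_linearIndependent_iff.1 hv
  -- Clearing denominators turns the dependence over `F(x)` into one with polynomial coefficients.
  obtain ⟨d, hd, h⟩ := exists_common_denominator (F := F) (x := x) Finset.univ
    (fun i : Fin (N + 1) ↦ (g i : K)) (fun i _ ↦ (g i).2)
  choose p hp using fun i ↦ h i (Finset.mem_univ i)
  let c : ℕ → F[X] := fun i ↦ if hi : i < N + 1 then p ⟨i, hi⟩ else 0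
  have hci (i : Fin (N + 1)) : c i = p i := dif_pos i.2
  obtain ⟨m, hm, h2⟩ := exists_leading_coefficient (fun (q : F[X]) i ↦ aeval x q * D^[i] (S * Φ))
    (by simp) N c
    (by
      refine ⟨i₀, by omega, fun h0 ↦ ?_⟩
      have := hp i₀
      rw [← hci, h0, map_zero] at this
      exact (mul_ne_zero (by simpa using hgi) hd) this)
    (by
      rw [Finset.sum_range]
      have := congrArg (fun w : LinearMap.range f ↦ (w : K) * aeval x d) hg
      simp only [AddSubmonoidClass.coe_finsetSum, Submodule.coe_smul, Algebra.smul_def,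
        ZeroMemClass.coe_zero, zero_mul, Finset.sum_mul] at this
      rw [← this]
      refine Finset.sum_congr rfl fun i _ ↦ ?_
      rw [hci, ← hp]
      simp [v]
      ring)
  exact ⟨m, c, hm, h2⟩

end Algebraic

/-! ### The Weierstrass zeta function -/

section Zeta

variable (L : PeriodPair)

/-- The three fractions add up to `s² / (l² (s - l))`, and `‖s - l‖ ≥ ‖l‖ / 2`. The exponent `-3` is
summable over a lattice of rank two. -/
lemma zeta_bound (r : ℝ) (hr : 0 < r) (s : ℂ) (hs : ‖s‖ < r) (l : ℂ) (h : 2 * r ≤ ‖l‖) :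
    ‖1 / (s - l) + 1 / l + s / l ^ 2‖ ≤ 2 * r ^ 2 * ‖l‖ ^ (-3 : ℝ) := by
  have hl : 0 < ‖l‖ := by linarith
  have hl0 : l ≠ 0 := norm_pos_iff.1 hl
  have hsl : ‖l‖ / 2 ≤ ‖s - l‖ := by
    rw [norm_sub_rev]
    exact le_trans (by linarith) (norm_sub_norm_le l s)
  have hsl0 : s - l ≠ 0 := norm_pos_iff.1 (lt_of_lt_of_le (by positivity) hsl)
  have h1 : 1 / (s - l) + 1 / l + s / l ^ 2 = s ^ 2 / (l ^ 2 * (s - l)) := by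
    field_simp
    ring
  calc
    _ = ‖s‖ ^ 2 / (‖l‖ ^ 2 * ‖s - l‖) := by rw [h1]; simp
    _ ≤ r ^ 2 / (‖l‖ ^ 2 * (‖l‖ / 2)) := by gcongr
    _ = 2 * r ^ 2 / ‖l‖ ^ 3 := by field
    _ = _ := by norm_cast

/-- The Weierstrass zeta function without the term of the lattice point `l₀`. -/
def zetaExcept (l₀ z : ℂ) : ℂ :=
  ∑' l : L.lattice, if l.1 = l₀ then 0 else 1 / (z - l.1) + 1 / l.1 + z / l.1 ^ 2

lemma hasSumLocallyUniformly_zetaExcept (l₀ : ℂ) :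
    HasSumLocallyUniformly (fun (l : L.lattice) (z : ℂ) ↦
      if l.1 = l₀ then 0 else 1 / (z - l.1) + 1 / l.1 + z / l.1 ^ 2) (zetaExcept L l₀) := by
  refine L.hasSumLocallyUniformly_aux (u := (2 * · ^ 2 * ‖·‖ ^ (-3 : ℝ))) _
    (fun _ _ ↦ (ZLattice.summable_norm_rpow _ _ (by simp; norm_num)).mul_left _) fun r hr ↦
    Filter.eventually_atTop.mpr ⟨2 * r, ?_⟩
  rintro _ h s hs l rfl
  split_ifs
  · rw [norm_zero]; positivity
  · exact zeta_bound r hr s hs l h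

lemma differentiableOn_zetaExcept (l₀ : ℂ) :
    DifferentiableOn ℂ (zetaExcept L l₀) (L.lattice \ {l₀})ᶜ := by
  refine (hasSumLocallyUniformly_zetaExcept L l₀).hasSumLocallyUniformlyOn.differentiableOn
    (.of_forall fun s ↦ .fun_sum fun i hi ↦ ?_) L.isOpen_compl_lattice_sdiff
  split_ifs with h
  · simp
  · refine .add (.add (.div (by fun_prop) (by fun_prop) fun x hx ↦ ?_) (by fun_prop)) (by fun_prop)
    rintro h0
    rw [sub_eq_zero] at h0
    exact hx ⟨h0 ▸ i.2, fun h1 ↦ h (h0 ▸ h1)⟩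

/-- Isolates the one term that is singular at `l₀`; the remaining sum is analytic there. -/
lemma weierstrassZeta_eq (l₀ : L.lattice) (z : ℂ) : weierstrassZeta L.ω₁ L.ω₂ z =
    zetaExcept L l₀ z + (1 / (z - l₀.1) + 1 / l₀.1 + z / l₀.1 ^ 2) := by
  symm
  trans zetaExcept L l₀ z + ∑' i : L.lattice,
    if i.1 = l₀.1 then (1 / (z - l₀.1) + 1 / l₀.1 + z / l₀.1 ^ 2) else 0
  · simp
  rw [zetaExcept, ← ((hasSumLocallyUniformly_zetaExcept L l₀).hasSum (x := z)).summable.tsum_add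
    ((hasSum_single l₀ (by simp +contextual)).summable)]
  refine tsum_congr fun l ↦ ?_
  split_ifs with h <;> simp [h]

lemma weierstrassZeta_eq_of_notMem {l₀ : ℂ} (hl₀ : l₀ ∉ L.lattice) :
    weierstrassZeta L.ω₁ L.ω₂ = zetaExcept L l₀ := by
  funext z
  refine tsum_congr fun l ↦ ?_
  rw [if_neg]
  rintro rfl
  exact hl₀ l.2

lemma meromorphic_weierstrassZeta : Meromorphic (weierstrassZeta L.ω₁ L.ω₂) := by
  intro z
  have hd : AnalyticAt ℂ (zetaExcept L z) z :=
    (differentiableOn_zetaExcept L z).analyticAt (L.compl_lattice_sdiff_singleton_mem_nhds z)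
  by_cases hz : z ∈ L.lattice
  · have h := funext (weierstrassZeta_eq L ⟨z, hz⟩)
    rw [h]
    have := hd.meromorphicAt
    fun_prop
  · rw [weierstrassZeta_eq_of_notMem L hz]
    exact hd.meromorphicAt

lemma differentiableAt_weierstrassZeta {z : ℂ} (hz : z ∉ L.lattice) :
    DifferentiableAt ℂ (weierstrassZeta L.ω₁ L.ω₂) z := by
  rw [weierstrassZeta_eq_of_notMem L hz]
  exact (differentiableOn_zetaExcept L z).differentiableAt
    (L.compl_lattice_sdiff_singleton_mem_nhds z)

/-- Locally uniform convergence permits termwise differentiation, which yields the series of `℘`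
with the opposite sign. -/
lemma deriv_weierstrassZeta {z : ℂ} (hz : z ∉ L.lattice) :
    deriv (weierstrassZeta L.ω₁ L.ω₂) z = -L.weierstrassP z := by
  rw [weierstrassZeta_eq_of_notMem L hz]
  have hterm (l : L.lattice) (w : ℂ) (hw : w ∉ L.lattice) :
      HasDerivAt (fun w ↦ if l.1 = z then 0 else 1 / (w - l.1) + 1 / l.1 + w / l.1 ^ 2)
        (-(1 / (w - l.1) ^ 2 - 1 / l.1 ^ 2)) w := by
    have h0 : w - l.1 ≠ 0 := fun h ↦ hw (sub_eq_zero.1 h ▸ l.2)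
    have h1 : l.1 ≠ z := fun h ↦ hz (h ▸ l.2)
    simp only [if_neg h1]
    have := (((hasDerivAt_id w).sub_const l.1).inv h0).add_const (1 / l.1) |>.add
      ((hasDerivAt_id w).div_const (l.1 ^ 2))
    convert! this using 1
    · funext w; simp
    · simp; ring
  have hopen : IsOpen (L.lattice : Set ℂ)ᶜ := L.isClosed_lattice.isOpen_compl
  have h1 := ((hasSumLocallyUniformly_zetaExcept L z).tendstoLocallyUniformlyOn.mono
    (Set.subset_univ _)).deriv
    (.of_forall fun s ↦ DifferentiableOn.fun_sum fun i _ w hw ↦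
      (hterm i w hw).differentiableAt.differentiableWithinAt) hopen
  have h2 := h1.tendsto_at (a := z) hz
  refine tendsto_nhds_unique h2 ?_
  have h3 := (L.hasSum_weierstrassP z).neg
  refine Tendsto.congr (fun s ↦ ?_) h3
  simp only [Function.comp_apply]
  rw [deriv_fun_sum fun i _ ↦ (hterm i z hz).differentiableAt]
  exact Finset.sum_congr rfl fun i _ ↦ (hterm i z hz).deriv.symm

end Zeta

/-! ### The uniformization -/

/-- A meromorphic function whose derivative vanishes is constant. -/
lemma exists_eq_const_of_deriv_eq_zero {f : ℂ → ℂ} (hf : Meromorphic f)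
    (h : ∀ᶠ z in codiscrete ℂ, deriv f z = 0) : ∃ c, ∀ᶠ z in codiscrete ℂ, f z = c := by
  have h1 := eventually_codiscrete_eventually_nhds (h.and (eventually_codiscrete_analyticAt hf))
  obtain ⟨z, hz⟩ := (eventually_codiscrete_iff.1 h1 0).exists
  obtain ⟨ε, hε, hball⟩ := Metric.eventually_nhds_iff_ball.1 hz
  have hconst : ∀ w ∈ Metric.ball z ε, f w = f z := fun w hw ↦
    Metric.isOpen_ball.is_const_of_deriv_eq_zero (convex_ball z ε).isPreconnected
      (fun y hy ↦ (hball y hy).2.differentiableAt.differentiableWithinAt)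
      (fun y hy ↦ (hball y hy).1) hw (Metric.mem_ball_self hε)
  refine ⟨f z, ?_⟩
  have h2 : ∀ᶠ w in codiscrete ℂ, f w - f z = 0 := by
    refine eventually_codiscrete_of_frequently (hf.sub (.const (f z))) (z := z) ?_
    refine Eventually.frequently ?_
    filter_upwards [nhdsWithin_le_nhds (Metric.ball_mem_nhds z hε)] with w hw
    simp [hconst w hw]
  exact h2.mono fun w hw ↦ sub_eq_zero.1 hw

/-- The pole at `0` prevents `℘` from being constant. -/
lemma eventually_weierstrassP_ne (L : PeriodPair) (c : ℂ) :
    ∀ᶠ z in codiscrete ℂ, L.weierstrassP z ≠ c := by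
  have hm : Meromorphic fun z ↦ L.weierstrassP z - c := L.meromorphic_weierstrassP.sub (.const c)
  refine (hm.eq_zero_or_ne_zero.resolve_left fun h ↦ ?_).mono fun z hz ↦ sub_ne_zero.1 hz
  have h1 : Tendsto L.weierstrassP (𝓝[≠] 0) (Bornology.cobounded ℂ) :=
    tendsto_cobounded_of_meromorphicOrderAt_neg (by
      rw [L.order_weierstrassP 0 (zero_mem _)]
      decide)
  have h2 : Tendsto L.weierstrassP (𝓝[≠] 0) (𝓝 c) := by
    refine tendsto_const_nhds.congr' ?_
    filter_upwards [eventually_codiscrete_iff.1 h 0] with z hz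
    exact (sub_eq_zero.1 hz).symm
  exact (h2.not_tendsto (Metric.disjoint_nhds_cobounded _)) h1

lemma eventually_notMem_lattice (L : PeriodPair) : ∀ᶠ z in codiscrete ℂ, z ∉ L.lattice := by
  rw [eventually_codiscrete_iff]
  intro z
  filter_upwards [nhdsWithin_le_nhds (L.compl_lattice_sdiff_singleton_mem_nhds z),
    self_mem_nhdsWithin] with w hw hwz hwL
  exact hw ⟨hwL, hwz⟩

/-- A translation that preserves the `℘`-function is a translation by a lattice point. -/
lemma mem_lattice_of_weierstrassP_add (L : PeriodPair) {a : ℂ}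
    (h : ∀ᶠ z in codiscrete ℂ, L.weierstrassP (z + a) = L.weierstrassP z) : a ∈ L.lattice := by
  -- Otherwise `℘` would have at `0` both a pole and the finite limit `℘(a)`.
  by_contra ha
  have h1 : Tendsto L.weierstrassP (𝓝[≠] 0) (Bornology.cobounded ℂ) :=
    tendsto_cobounded_of_meromorphicOrderAt_neg (by
      rw [L.order_weierstrassP 0 (zero_mem _)]
      decide)
  have h2 : Tendsto L.weierstrassP (𝓝[≠] 0) (𝓝 (L.weierstrassP a)) := by
    refine Tendsto.congr' (eventually_codiscrete_iff.1 h 0) ?_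
    have h3 : ContinuousAt (fun z ↦ L.weierstrassP (z + a)) 0 := by
      refine ContinuousAt.comp_of_eq (f := fun z ↦ z + a)
        (L.analyticOnNhd_weierstrassP a ha).continuousAt (by fun_prop) (zero_add a)
    simpa [ContinuousAt] using h3.tendsto.mono_left (nhdsWithin_le_nhds (s := {0}ᶜ))
  exact (h2.not_tendsto (Metric.disjoint_nhds_cobounded _)) h1

variable {r : Fin 3 → Fin 3 → ℂ}

lemma natDegree_disc_le : (disc r).natDegree ≤ 4 := by
  simp only [disc, polyA, polyB, polyC, Fin.sum_univ_three]
  compute_degree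

lemma GenusOne.coeff_three_ne_zero (h : GenusOne r) (h4 : (disc r).coeff 4 = 0) :
    (disc r).coeff 3 ≠ 0 := by
  have h3 : (disc r).natDegree = 3 := by
    refine le_antisymm ?_ h.1
    by_contra hlt
    have h5 : (disc r).natDegree = 4 := le_antisymm natDegree_disc_le (by omega)
    have h0 : (disc r).leadingCoeff = 0 := by rw [leadingCoeff, h5, h4]
    rw [leadingCoeff_eq_zero.1 h0] at h5
    simp at h5
  have h0 : (disc r).leadingCoeff ≠ 0 := by
    rw [Ne, leadingCoeff_eq_zero]
    intro h0
    rw [h0] at h3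
    simp at h3
  rwa [leadingCoeff, h3] at h0

lemma GenusOne.eval_derivative_ne_zero (h : GenusOne r) {t : ℂ} (ht : (disc r).IsRoot t) :
    (disc r).derivative.eval t ≠ 0 := by
  have hs : (disc r).Separable := PerfectField.separable_iff_squarefree.2 h.2
  have := hs.aeval_derivative_ne_zero (x := t) (by simpa using ht)
  simpa using this

/-- If `a = 0`, then `D = b²`; being squarefree, it would be constant. -/
lemma GenusOne.polyA_ne_zero (h : GenusOne r) : polyA r ≠ 0 := by
  intro hA
  have h1 : disc r = polyB r * polyB r := by rw [disc, hA]; ring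
  have h2 : IsUnit (polyB r) := h.2 _ (by rw [h1])
  have h3 := h.1
  rw [h1, natDegree_mul h2.ne_zero h2.ne_zero, natDegree_eq_zero_of_isUnit h2] at h3
  omega

section Cover

variable {x₄ : ℂ} {L : PeriodPair}

lemma weierstrassP_eq_g (hg : GenusOne r) (hL : IsUniformization r x₄ L) {ω : ℂ}
    (hω : (disc r).coeff 4 ≠ 0 → L.weierstrassP ω ≠ (disc r).derivative.derivative.eval x₄ / 6) :
    L.weierstrassP ω = g r x₄ (xCov r x₄ L ω) := by
  by_cases h4 : (disc r).coeff 4 = 0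
  · have := hg.coeff_three_ne_zero h4
    simp only [g, xCov, h4, ne_eq, not_true_eq_false, if_false]
    field_simp
    ring
  · have h1 := hg.eval_derivative_ne_zero (hL.1 h4)
    have h2 := sub_ne_zero.2 (hω h4)
    simp only [g, xCov, h4, ne_eq, not_false_eq_true, if_true, add_sub_cancel_left]
    rw [div_div_cancel₀ h1]
    ring

/-- No point needs to be excepted: at `t = x₄` the convention `1 / 0 = 0` makes `g` equal to
`D''(x₄) / 6` and then `x(ω)` equal to `x₄`. -/
lemma xCov_eq_of_weierstrassP_eq_g (hg : GenusOne r) (hL : IsUniformization r x₄ L) {ω t : ℂ}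
    (h : L.weierstrassP ω = g r x₄ t) : xCov r x₄ L ω = t := by
  by_cases h4 : (disc r).coeff 4 = 0
  · have := hg.coeff_three_ne_zero h4
    simp only [g, xCov, h4, ne_eq, not_true_eq_false, if_false] at h ⊢
    rw [h]
    field_simp
    ring
  · have h1 := hg.eval_derivative_ne_zero (hL.1 h4)
    simp only [g, xCov, h4, ne_eq, not_false_eq_true, if_true] at h ⊢
    rw [h, add_sub_cancel_left, div_div_cancel₀ h1]
    ring

lemma eventually_weierstrassP_eq_g (hg : GenusOne r) (hL : IsUniformization r x₄ L) :
    ∀ᶠ ω in codiscrete ℂ, L.weierstrassP ω = g r x₄ (xCov r x₄ L ω) :=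
  (eventually_weierstrassP_ne L _).mono fun _ hω ↦ weierstrassP_eq_g hg hL fun _ ↦ hω

lemma eventually_xCov_ne (hg : GenusOne r) (hL : IsUniformization r x₄ L) (c : ℂ) :
    ∀ᶠ ω in codiscrete ℂ, xCov r x₄ L ω ≠ c := by
  filter_upwards [eventually_weierstrassP_eq_g hg hL, eventually_weierstrassP_ne L (g r x₄ c)]
    with ω h1 h2 h3
  rw [h3] at h1
  exact h2 h1

variable (r x₄ L) in
lemma meromorphic_xCov : Meromorphic (xCov r x₄ L) := by
  have : Meromorphic L.weierstrassP := L.meromorphic_weierstrassP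
  unfold xCov
  split_ifs <;> fun_prop

variable (r x₄ L) in
lemma meromorphic_uCov : Meromorphic (uCov r x₄ L) := by
  have : Meromorphic L.weierstrassP := L.meromorphic_weierstrassP
  have : Meromorphic L.derivWeierstrassP := L.meromorphic_derivWeierstrassP
  unfold uCov
  split_ifs <;> fun_prop

variable (r x₄ L) in
lemma meromorphic_yCov : Meromorphic (yCov r x₄ L) :=
  ((meromorphic_uCov r x₄ L).sub (MeroField.meromorphic_eval _ (meromorphic_xCov r x₄ L))).div
    ((Meromorphic.const 2).mul (MeroField.meromorphic_eval _ (meromorphic_xCov r x₄ L)))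

lemma xCov_add {l : ℂ} (hl : l ∈ L.lattice) (z : ℂ) : xCov r x₄ L (z + l) = xCov r x₄ L z := by
  simp only [xCov, L.weierstrassP_add_coe z ⟨l, hl⟩]

lemma yCov_add {l : ℂ} (hl : l ∈ L.lattice) (z : ℂ) : yCov r x₄ L (z + l) = yCov r x₄ L z := by
  simp only [yCov, uCov, xCov_add hl, L.weierstrassP_add_coe z ⟨l, hl⟩,
    L.derivWeierstrassP_add_coe z ⟨l, hl⟩]

lemma eventually_deriv_xCov_ne_zero (hg : GenusOne r) (hL : IsUniformization r x₄ L) :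
    ∀ᶠ ω in codiscrete ℂ, deriv (xCov r x₄ L) ω ≠ 0 := by
  refine (meromorphic_xCov r x₄ L).deriv.eq_zero_or_ne_zero.resolve_left fun h ↦ ?_
  obtain ⟨c, hc⟩ := exists_eq_const_of_deriv_eq_zero (meromorphic_xCov r x₄ L) h
  obtain ⟨z, h1, h2⟩ := ((eventually_codiscrete_iff.1 hc 0).and
    (eventually_codiscrete_iff.1 (eventually_xCov_ne hg hL c) 0)).exists
  exact h2 h1

lemma eventually_eval_xCov_ne_zero (hg : GenusOne r) (hL : IsUniformization r x₄ L) {P : ℂ[X]}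
    (hP : P ≠ 0) : ∀ᶠ ω in codiscrete ℂ, P.eval (xCov r x₄ L ω) ≠ 0 := by
  have h : ∀ᶠ ω in codiscrete ℂ, ∀ c ∈ P.roots.toFinset, xCov r x₄ L ω ≠ c :=
    (eventually_all_finset _).2 fun c _ ↦ eventually_xCov_ne hg hL c
  filter_upwards [h] with ω hω h0
  exact hω _ (by simpa [hP] using h0) rfl

lemma evalEval_kernel (s t : ℂ) : (kernel r).evalEval s t =
    (polyA r).eval s * t ^ 2 + (polyB r).eval s * t + (polyC r).eval s := by
  simp [kernel, evalEval]

/-- Completing the square, `4aQ = u² - D` with `u = 2ay + b`. -/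
lemma eventually_evalEval_kernel (hg : GenusOne r) (hL : IsUniformization r x₄ L) :
    ∀ᶠ ω in codiscrete ℂ, (kernel r).evalEval (xCov r x₄ L ω) (yCov r x₄ L ω) = 0 := by
  filter_upwards [eventually_notMem_lattice L, eventually_weierstrassP_ne L
    ((disc r).derivative.derivative.eval x₄ / 6), eventually_eval_xCov_ne_zero hg hL
    hg.polyA_ne_zero] with ω h1 h2 h3
  have h4 := hL.2 ω h1 fun _ ↦ h2
  rw [evalEval_kernel, yCov]
  simp only [disc, eval_sub, eval_pow, eval_mul, eval_ofNat] at h4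
  field_simp
  linear_combination h4

end Cover

/-! ### Rational functions on the curve as meromorphic functions -/

section Lift

variable {r : Fin 3 → Fin 3 → ℂ} {x₄ : ℂ} {L : PeriodPair}

lemma meromorphic_evalEval (P : ℂ[X][X]) {f g : ℂ → ℂ} (hf : Meromorphic f) (hg : Meromorphic g) :
    Meromorphic fun z ↦ P.evalEval (f z) (g z) := by
  induction P using Polynomial.induction_on' with
  | add p q hp hq =>
    simp only [evalEval_add]
    exact hp.add hq
  | monomial n a =>
    have : (fun z ↦ (monomial n a).evalEval (f z) (g z)) = fun z ↦ a.eval (f z) * g z ^ n := by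
      funext z
      simp [evalEval]
    rw [this]
    exact (MeroField.meromorphic_eval a hf).mul hg.pow

lemma MeroField.mk_evalEval (P : ℂ[X][X]) {f g : ℂ → ℂ} (hf : Meromorphic f)
    (hg : Meromorphic g) : mk (fun z ↦ P.evalEval (f z) (g z)) (meromorphic_evalEval P hf hg) =
      P.eval₂ (aeval (mk f hf) : ℂ[X] →ₐ[ℂ] MeroField).toRingHom (mk g hg) := by
  induction P using Polynomial.induction_on' with
  | add p q hp hq =>
    rw [eval₂_add, ← hp, ← hq, ← mk_add, mk_eq_mk]
    exact .of_forall fun z ↦ evalEval_add _ _ _ _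
  | monomial n a =>
    rw [eval₂_monomial, ← mk_pow]
    change _ = aeval (mk f hf) a * _
    rw [← mk_eval, ← mk_mul, mk_eq_mk]
    exact .of_forall fun z ↦ by simp [evalEval]

variable (r x₄ L) in
/-- The function `x(ω)` in the field of meromorphic functions. -/
def meroX : MeroField := .mk (xCov r x₄ L) (meromorphic_xCov r x₄ L)

variable (r x₄ L) in
/-- The function `y(ω)` in the field of meromorphic functions. -/
def meroY : MeroField := .mk (yCov r x₄ L) (meromorphic_yCov r x₄ L)

/-- The function `x(ω)` is transcendental over `ℂ`, since it takes each value on a discrete set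
only. -/
lemma eq_zero_of_aeval_meroX (hg : GenusOne r) (hL : IsUniformization r x₄ L) {P : ℂ[X]}
    (h : aeval (meroX r x₄ L) P = 0) : P = 0 := by
  by_contra hP
  rw [meroX, ← MeroField.mk_eval, MeroField.mk_eq_zero] at h
  obtain ⟨z, h1, h2⟩ := ((eventually_codiscrete_iff.1 h 0).and
    (eventually_codiscrete_iff.1 (eventually_eval_xCov_ne_zero hg hL hP) 0)).exists
  exact h2 h1

/-- The homomorphism from the coordinate ring of the curve to the field of meromorphic
functions. -/
def coordRingToMero (hg : GenusOne r) (hL : IsUniformization r x₄ L) :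
    CoordRing r →+* MeroField :=
  AdjoinRoot.lift (aeval (meroX r x₄ L) : ℂ[X] →ₐ[ℂ] MeroField).toRingHom (meroY r x₄ L) (by
    rw [meroX, meroY, ← MeroField.mk_evalEval, MeroField.mk_eq_zero]
    exact eventually_evalEval_kernel hg hL)

lemma coordRingToMero_mk (hg : GenusOne r) (hL : IsUniformization r x₄ L) (P : ℂ[X][X]) :
    coordRingToMero hg hL (AdjoinRoot.mk (kernel r) P) =
      .mk (fun ω ↦ P.evalEval (xCov r x₄ L ω) (yCov r x₄ L ω))
        (meromorphic_evalEval P (meromorphic_xCov r x₄ L) (meromorphic_yCov r x₄ L)) := by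
  rw [coordRingToMero, AdjoinRoot.lift_mk, MeroField.mk_evalEval]
  rfl

lemma natDegree_kernel (hg : GenusOne r) : (kernel r).natDegree = 2 :=
  natDegree_quadratic hg.polyA_ne_zero

lemma meromorphic_onCover (h : FunField r) : Meromorphic (onCover x₄ L h) := by
  unfold onCover
  exact (meromorphic_evalEval _ (meromorphic_xCov r x₄ L) (meromorphic_yCov r x₄ L)).div
    (meromorphic_evalEval _ (meromorphic_xCov r x₄ L) (meromorphic_yCov r x₄ L))

lemma onCover_add (h : FunField r) {l : ℂ} (hl : l ∈ L.lattice) (ω : ℂ) :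
    onCover x₄ L h (ω + l) = onCover x₄ L h ω := by
  simp only [onCover, xCov_add hl, yCov_add hl]

lemma isAlgebraic_coordRing (hg : GenusOne r) (s : CoordRing r) : IsAlgebraic ℂ[X] s := by
  have hker : kernel r ≠ 0 := ne_zero_of_natDegree_gt (n := 1) (by rw [natDegree_kernel hg]; simp)
  induction s using AdjoinRoot.induction_on with
  | ih p =>
    induction p using Polynomial.induction_on' with
    | add p q hp hq =>
      rw [map_add]
      exact hp.add hq
    | monomial n a =>
      rw [← C_mul_X_pow_eq_monomial, map_mul, map_pow, AdjoinRoot.mk_X, AdjoinRoot.mk_C]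
      refine IsAlgebraic.mul (isAlgebraic_algebraMap (A := CoordRing r) a) (IsAlgebraic.pow ?_ n)
      exact ⟨kernel r, hker, by rw [AdjoinRoot.aeval_eq, AdjoinRoot.mk_self]⟩

variable [Fact (Irreducible (kernel r))]

/-- A nonzero `s` is algebraic over `ℂ[x]`, so it divides a nonzero polynomial in `x`. If `s` were
mapped to `0`, so would be that polynomial, contradicting the transcendence of `x(ω)`. -/
lemma coordRingToMero_injective (hg : GenusOne r) (hL : IsUniformization r x₄ L) :
    Function.Injective (coordRingToMero hg hL) := by
  refine (injective_iff_map_eq_zero _).2 fun s hs ↦ by_contra fun h0 ↦ ?_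
  obtain ⟨p, hp, t, ht⟩ := (isAlgebraic_coordRing hg s).exists_nonzero_dvd
    (mem_nonZeroDivisors_of_ne_zero h0)
  refine hp (eq_zero_of_aeval_meroX hg hL ?_)
  have h1 := congrArg (coordRingToMero hg hL) ht
  rw [map_mul, hs, zero_mul] at h1
  rw [← h1]
  exact (AdjoinRoot.lift_of (f := kernel r) _).symm

/-- The homomorphism from the function field of the curve to the field of meromorphic
functions. -/
def funFieldToMero (hg : GenusOne r) (hL : IsUniformization r x₄ L) : FunField r →+* MeroField :=
  IsFractionRing.lift (coordRingToMero_injective hg hL)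

/-- Despite the choices in `onCover`, its class is the image under a field homomorphism; hence
identities in the function field pass to the covering, and conversely by injectivity. -/
lemma funFieldToMero_eq (hg : GenusOne r) (hL : IsUniformization r x₄ L) (h : FunField r) :
    funFieldToMero hg hL h = .mk (onCover x₄ L h) (meromorphic_onCover h) := by
  set p := IsLocalization.sec (nonZeroDivisors (CoordRing r)) h with hp
  have h1 : h = IsLocalization.mk' (FunField r) p.1 p.2 := (IsLocalization.mk'_sec _ h).symm
  conv_lhs => rw [h1]
  rw [funFieldToMero, IsFractionRing.lift_mk']
  conv_lhs => rw [← (AdjoinRoot.mk_surjective p.1).choose_spec,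
    ← (AdjoinRoot.mk_surjective (p.2 : CoordRing r)).choose_spec]
  rw [coordRingToMero_mk, coordRingToMero_mk, ← MeroField.mk_div]
  rfl

lemma eventually_onCover_coordX (hg : GenusOne r) (hL : IsUniformization r x₄ L) :
    onCover x₄ L (coordX r) =ᶠ[codiscrete ℂ] xCov r x₄ L := by
  rw [← MeroField.mk_eq_mk (hf := meromorphic_onCover _) (hg := meromorphic_xCov r x₄ L),
    ← funFieldToMero_eq hg hL, coordX, ofPoly, funFieldToMero, IsFractionRing.lift_algebraMap,
    coordRingToMero_mk, MeroField.mk_eq_mk]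
  exact .of_forall fun ω ↦ (evalEval_C _ _ _).trans eval_X

end Lift

/-! ### The translation -/

section Translation

variable {r : Fin 3 → Fin 3 → ℂ}

lemma ofPoly_eq (P : ℂ[X][X]) :
    ofPoly r P = P.eval₂ (aeval (coordX r) : ℂ[X] →ₐ[ℂ] FunField r).toRingHom (coordY r) := by
  let f : ℂ[X][X] →+* FunField r :=
    (algebraMap (CoordRing r) (FunField r)).comp (AdjoinRoot.mk (kernel r))
  have h : f = eval₂RingHom (aeval (coordX r) : ℂ[X] →ₐ[ℂ] FunField r).toRingHom (coordY r) := by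
    refine Polynomial.ringHom_ext' (Polynomial.ringHom_ext' ?_ ?_) ?_
    · ext c
      trans algebraMap ℂ (FunField r) c
      · exact (IsScalarTower.algebraMap_apply ℂ (CoordRing r) (FunField r) c).symm
      · simp
    · simp [f, coordX, ofPoly]
    · simp [f, coordY, ofPoly]
  exact congrArg (fun F : ℂ[X][X] →+* FunField r ↦ F P) h

lemma ofPoly_eq_zero_iff (P : ℂ[X][X]) : ofPoly r P = 0 ↔ kernel r ∣ P := by
  rw [ofPoly, FaithfulSMul.algebraMap_eq_zero_iff, AdjoinRoot.mk_eq_zero]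

variable [Fact (Irreducible (kernel r))] {x₄ : ℂ} {L : PeriodPair}
  {δ : FunField r ≃ₐ[ℂ] FunField r} {ω₃ : ℂ}

lemma IsTranslation.pow (hδ : IsTranslation x₄ L δ ω₃) (k : ℕ) (h : FunField r) :
    ∀ᶠ ω in codiscrete ℂ, onCover x₄ L ((δ ^ k) h) ω = onCover x₄ L h (ω + k * ω₃) := by
  induction k with
  | zero => simp
  | succ k ih =>
    filter_upwards [hδ ((δ ^ k) h), eventually_codiscrete_add ih ω₃] with ω h1 h2
    rw [pow_succ', AlgEquiv.mul_apply, h1, h2]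
    congr 1
    push_cast
    ring

/-- Applied to the function `x`, the translation by `Nω₃` preserves `x(ω)`, hence `℘ = g(x(ω))`. -/
lemma IsTranslation.mul_mem_lattice (hg : GenusOne r) (hL : IsUniformization r x₄ L)
    (hδ : IsTranslation x₄ L δ ω₃) {N : ℕ} (hN : δ ^ N = 1) : N * ω₃ ∈ L.lattice := by
  refine mem_lattice_of_weierstrassP_add L ?_
  filter_upwards [hδ.pow N (coordX r), eventually_onCover_coordX hg hL,
    eventually_codiscrete_add (eventually_onCover_coordX hg hL) (N * ω₃),
    eventually_weierstrassP_eq_g hg hL,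
    eventually_codiscrete_add (eventually_weierstrassP_eq_g hg hL) (N * ω₃)] with ω h1 h2 h3 h4 h5
  rw [hN, AlgEquiv.one_apply, h2, h3] at h1
  rw [h4, h5, h1]

lemma IsTranslation.apply_eq_self (hg : GenusOne r) (hL : IsUniformization r x₄ L)
    (hδ : IsTranslation x₄ L δ 0) (h : FunField r) : δ h = h := by
  apply (funFieldToMero hg hL).injective
  rw [funFieldToMero_eq, funFieldToMero_eq, MeroField.mk_eq_mk]
  filter_upwards [hδ h] with ω hω
  rw [hω, add_zero]

/-- No kernel of genus one has `η(x) = x`. -/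
lemma IsEta.apply_coordX_ne (hg : GenusOne r) {η : FunField r ≃ₐ[ℂ] FunField r} (hη : IsEta η) :
    η (coordX r) ≠ coordX r := by
  intro h
  have hA := hg.polyA_ne_zero
  -- `P = ∂Q/∂x`. If `η(x) = x`, then `x² ã(y) = c̃(y)` on the curve, so `x * P = Q + x² ã - c̃`
  -- vanishes there, and `Q ∣ P`.
  set P : ℂ[X][X] := C (derivative (polyA r)) * X ^ 2 + C (derivative (polyB r)) * X +
    C (derivative (polyC r)) with hP
  have hx : coordX r ≠ 0 := by
    rw [coordX, Ne, ofPoly_eq_zero_iff]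
    intro hdvd
    have := natDegree_le_of_dvd hdvd (C_ne_zero.2 X_ne_zero)
    rw [natDegree_kernel hg, natDegree_C] at this
    omega
  have hP0 : ofPoly r P = 0 := by
    have hk : ofPoly r (kernel r) = 0 := (ofPoly_eq_zero_iff _).2 dvd_rfl
    have h1 := hη.1
    rw [h] at h1
    have hA' : aeval (coordY r) (polyA' r) ≠ 0 := by
      intro h0
      rw [h0, div_zero, mul_zero] at h1
      exact hx h1
    rw [ofPoly_eq] at hk ⊢
    field_simp at h1
    simp only [kernel, polyA, polyB, polyC, polyA', polyC', hP, Fin.sum_univ_three, eval₂_add,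
      eval₂_mul, eval₂_pow, eval₂_C, eval₂_X, AlgHom.toRingHom_eq_coe, RingHom.coe_coe, map_add,
      map_mul, map_pow, aeval_C, aeval_X, derivative_mul, derivative_C,
      derivative_X_pow, Fin.val_zero, Fin.val_one, Fin.val_two, map_zero] at hk h1 ⊢
    simp only [map_ofNat, pow_zero, pow_one, mul_one, Nat.cast_ofNat, Nat.cast_one,
      map_one, Nat.cast_zero, eval₂_zero, map_zero, tsub_self] at hk h1 ⊢
    refine (mul_right_inj' hx).1 ?_
    linear_combination hk + h1
  obtain ⟨e, he⟩ := (ofPoly_eq_zero_iff _).1 hP0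
  -- By degrees in `y`, a nonzero `e` would be a polynomial `d(x)` with `a' = a * d`, impossible by
  -- degrees in `x`. So `∂Q/∂x = 0`, and then `D` is constant.
  have he0 : e = 0 := by
    by_contra he0
    have hk0 : kernel r ≠ 0 := ne_zero_of_natDegree_gt (n := 1) (by rw [natDegree_kernel hg]; simp)
    have h1 : P.natDegree ≤ 2 := natDegree_quadratic_le
    rw [he, natDegree_mul hk0 he0, natDegree_kernel hg] at h1
    obtain ⟨d, rfl⟩ : ∃ d, e = C d := natDegree_eq_zero.1 (by omega) |>.imp fun _ h ↦ h.symm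
    have h2 := congrArg (fun p : ℂ[X][X] ↦ p.coeff 2) he
    have h3 : derivative (polyA r) = polyA r * d := by
      simpa [hP, kernel, coeff_X, coeff_C] using h2
    have h4 := degree_derivative_lt hA
    rw [h3, degree_mul] at h4
    have h5 : 0 ≤ d.degree := zero_le_degree_iff.2 fun h ↦ he0 (by rw [h, C_0])
    exact absurd h4 (not_lt.2 (le_add_of_nonneg_right h5))
  rw [he0, mul_zero] at he
  have hcoeff (n : ℕ) : P.coeff n = 0 := by rw [he, coeff_zero]
  have hA1 : derivative (polyA r) = 0 := by simpa [hP, coeff_X, coeff_C] using hcoeff 2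
  have hB1 : derivative (polyB r) = 0 := by simpa [hP, coeff_X, coeff_C] using hcoeff 1
  have hC1 : derivative (polyC r) = 0 := by simpa [hP, coeff_X, coeff_C] using hcoeff 0
  have hD : derivative (disc r) = 0 := by
    simp [disc, hA1, hB1, hC1, derivative_pow]
  have := hg.1
  rw [derivative_eq_zero.1 hD] at this
  omega

end Translation

/-! ### Differentiation with respect to `x` along a branch -/

/-- The iterated derivatives of `w` with respect to `x`. -/
def iteratedDerivWrt (x w : ℂ → ℂ) : ℕ → ℂ → ℂ
  | 0 => w
  | i + 1 => deriv (iteratedDerivWrt x w i) / deriv x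

lemma meromorphic_iteratedDerivWrt {x w : ℂ → ℂ} (hx : Meromorphic x) (hw : Meromorphic w) (i : ℕ) :
    Meromorphic (iteratedDerivWrt x w i) := by
  induction i with
  | zero => exact hw
  | succ i ih => exact ih.deriv.div hx.deriv

lemma mk_iteratedDerivWrt {x w : ℂ → ℂ} (hx : Meromorphic x) (hw : Meromorphic w) (i : ℕ) :
    MeroField.mk (iteratedDerivWrt x w i) (meromorphic_iteratedDerivWrt hx hw i) =
      ((MeroField.D (MeroField.mk x hx))⁻¹ • MeroField.D)^[i] (MeroField.mk w hw) := by
  induction i with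
  | zero => rfl
  | succ i ih =>
    rw [Function.iterate_succ_apply', ← ih, Derivation.smul_apply, MeroField.D_mk, MeroField.D_mk,
      smul_eq_mul, mul_comm, ← div_eq_mul_inv, ← MeroField.mk_div]
    rfl

/-- A right inverse is injective near `t`, so it avoids the value `φ t` at nearby points and
codiscrete statements can be pulled back along it. -/
lemma tendsto_of_right_inverse {x φ : ℂ → ℂ} {t : ℂ} (hφ : ContinuousAt φ t)
    (h : ∀ᶠ s in 𝓝 t, x (φ s) = s) : Tendsto φ (𝓝[≠] t) (𝓝[≠] (φ t)) := by
  refine tendsto_nhdsWithin_iff.2 ⟨hφ.tendsto.mono_left nhdsWithin_le_nhds, ?_⟩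
  filter_upwards [h.filter_mono nhdsWithin_le_nhds, self_mem_nhdsWithin] with s hs hst hφs
  refine hst ?_
  rw [Set.mem_singleton_iff] at hφs ⊢
  rw [← hs, hφs, h.self_of_nhds]

/-- Differentiating `x(φ(s)) = s` gives `φ' = 1 / x'(φ)`, so `d/ds` corresponds to `(1 / x') d/dω`.
The point `t` is left out because `φ t` may be a pole. -/
lemma iteratedDeriv_comp_eventuallyEq {x w φ : ℂ → ℂ} {t : ℂ} (hx : Meromorphic x)
    (hw : Meromorphic w) (hφ : AnalyticAt ℂ φ t) (h : ∀ᶠ s in 𝓝 t, x (φ s) = s) (i : ℕ) :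
    iteratedDeriv i (w ∘ φ) =ᶠ[𝓝[≠] t] iteratedDerivWrt x w i ∘ φ := by
  induction i with
  | zero => simp [iteratedDerivWrt]
  | succ i ih =>
    have ht := tendsto_of_right_inverse hφ.continuousAt h
    have hW := meromorphic_iteratedDerivWrt hx hw i
    filter_upwards [ht.eventually (hx (φ t)).eventually_analyticAt,
      ht.eventually (hW (φ t)).eventually_analyticAt,
      hφ.eventually_analyticAt.filter_mono nhdsWithin_le_nhds,
      h.eventually_nhds.filter_mono nhdsWithin_le_nhds, eventually_eventually_nhdsWithin.2 ih,
      self_mem_nhdsWithin] with s h1 h2 h3 h4 h5 hst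
    rw [IsOpen.nhdsWithin_eq isOpen_compl_singleton hst] at h5
    have h6 : deriv x (φ s) * deriv φ s = 1 := by
      rw [← deriv_comp s h1.differentiableAt h3.differentiableAt]
      exact (EventuallyEq.deriv_eq h4).trans (deriv_id s)
    rw [iteratedDeriv_succ, EventuallyEq.deriv_eq h5,
      deriv_comp s h2.differentiableAt h3.differentiableAt]
    simp only [Function.comp_apply, iteratedDerivWrt, Pi.div_apply]
    rw [div_eq_mul_inv, ← eq_inv_of_mul_eq_one_right h6]

/-- A differential equation with respect to `x` holds for all analytic branches. -/
lemma ode_of_branch {x w φ : ℂ → ℂ} {t : ℂ} (hx : Meromorphic x)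
    (hw : Meromorphic w) (hφ : AnalyticAt ℂ φ t) (h : ∀ᶠ s in 𝓝 t, x (φ s) = s)
    (hF : AnalyticAt ℂ (w ∘ φ) t) {m : ℕ} {c : ℕ → ℂ[X]}
    (hc : ∀ᶠ z in codiscrete ℂ,
      ∑ i ∈ Finset.range (m + 1), (c i).eval (x z) * iteratedDerivWrt x w i z = 0) :
    ∑ i ∈ Finset.range (m + 1), (c i).eval t * iteratedDeriv i (w ∘ φ) t = 0 := by
  have ht := tendsto_of_right_inverse hφ.continuousAt h
  have hcont : ContinuousAt (fun s ↦ ∑ i ∈ Finset.range (m + 1),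
      (c i).eval s * iteratedDeriv i (w ∘ φ) s) t := by
    refine tendsto_finsetSum _ fun i _ ↦ ContinuousAt.mul (c i).continuousAt ?_
    rw [iteratedDeriv_eq_iterate]
    exact (hF.iterated_deriv i).continuousAt
  -- The equation holds on a punctured neighbourhood of `t` and extends to `t` by continuity.
  refine tendsto_nhds_unique (hcont.tendsto.mono_left (nhdsWithin_le_nhds (s := {t}ᶜ))) ?_
  refine tendsto_const_nhds.congr' ?_
  have hall : ∀ᶠ s in 𝓝[≠] t, ∀ i ∈ Finset.range (m + 1),
      iteratedDeriv i (w ∘ φ) s = iteratedDerivWrt x w i (φ s) :=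
    (eventually_all_finset _).2 fun i _ ↦ iteratedDeriv_comp_eventuallyEq hx hw hφ h i
  filter_upwards [hall, ht.eventually (eventually_codiscrete_iff.1 hc (φ t)),
    h.filter_mono nhdsWithin_le_nhds] with s h1 h2 h3
  rw [← h2]
  refine Finset.sum_congr rfl fun i hi ↦ ?_
  rw [h1 i hi, h3]

/-! ### Periods -/

/-- The pair of periods `(ω₁, t ω₂)`. -/
def scalePeriod (L : PeriodPair) (t : ℝ) (ht : t ≠ 0) : PeriodPair where
  ω₁ := L.ω₁
  ω₂ := t * L.ω₂
  indep := by
    rw [LinearIndependent.pair_iff]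
    intro a b hab
    have h := LinearIndependent.pair_iff.1 L.indep a (b * t) (by
      rw [← hab]
      simp [mul_assoc])
    exact ⟨h.1, (mul_eq_zero.1 h.2).resolve_right ht⟩

lemma lattice_scalePeriod_le {L M : PeriodPair} {t : ℝ} {ht : t ≠ 0} (h1 : L.ω₁ ∈ M.lattice)
    (h2 : t * L.ω₂ ∈ M.lattice) : (scalePeriod L t ht).lattice ≤ M.lattice := by
  rw [PeriodPair.lattice, Submodule.span_le]
  rintro z (rfl | rfl)
  · exact h1
  · exact h2

/-- A real multiple of `ω₂` in the lattice is an integer multiple. -/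
lemma exists_int_of_mem_lattice {L : PeriodPair} {s : ℝ} (h : s * L.ω₂ ∈ L.lattice) :
    ∃ k : ℤ, s = k := by
  obtain ⟨m, k, hmk⟩ := PeriodPair.mem_lattice.1 h
  have := LinearIndependent.pair_iff.1 L.indep m (k - s) (by
    simp
    linear_combination hmk)
  exact ⟨k, by linarith [this.2]⟩

/-! ### The function `Φ̃` -/

section PhiTilde

variable (L : PeriodPair)

lemma meromorphic_phiTilde {s : ℝ} (hs : s ≠ 0) : Meromorphic (phiTilde L.ω₁ L.ω₂ (s * L.ω₂)) := by
  have h : Meromorphic fun ω ↦ weierstrassZeta L.ω₁ (s * L.ω₂) (ω - L.ω₂ / 2) := fun z ↦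
    (meromorphic_weierstrassZeta (scalePeriod L s hs) _).comp_analyticAt (by fun_prop)
  unfold phiTilde
  have h2 : Meromorphic fun ω : ℂ ↦ ω - L.ω₂ / 2 := fun z ↦
    (by fun_prop : AnalyticAt ℂ (fun ω : ℂ ↦ ω - L.ω₂ / 2) z).meromorphicAt
  exact ((Meromorphic.const _).mul h).sub ((h2.div (Meromorphic.const _)).mul (Meromorphic.const _))

lemma deriv_phiTilde {s : ℝ} (hs : s ≠ 0) : deriv (phiTilde L.ω₁ L.ω₂ (s * L.ω₂)) =ᶠ[codiscrete ℂ] fun ω ↦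
    L.ω₁ / (2 * Complex.I * Real.pi) * -(scalePeriod L s hs).weierstrassP (ω - L.ω₂ / 2) -
      1 / (Complex.I * Real.pi) * weierstrassZeta L.ω₁ (s * L.ω₂) (L.ω₁ / 2) := by
  filter_upwards [eventually_codiscrete_add (eventually_notMem_lattice (scalePeriod L s hs))
    (-(L.ω₂ / 2))] with ω hω
  rw [← sub_eq_add_neg] at hω
  have h1 : HasDerivAt (weierstrassZeta L.ω₁ (s * L.ω₂))
      (-(scalePeriod L s hs).weierstrassP (ω - L.ω₂ / 2)) (ω - L.ω₂ / 2) := by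
    rw [← deriv_weierstrassZeta _ hω]
    exact (differentiableAt_weierstrassZeta _ hω).hasDerivAt
  have h2 : HasDerivAt (fun ω : ℂ ↦ ω - L.ω₂ / 2) 1 ω := (hasDerivAt_id ω).sub_const _
  have h3 := ((h1.comp ω h2).const_mul (L.ω₁ / (2 * Complex.I * Real.pi))).sub
    ((h2.div_const (Complex.I * Real.pi)).mul_const
      (weierstrassZeta L.ω₁ (s * L.ω₂) (L.ω₁ / 2)))
  rw [mul_one] at h3
  exact h3.deriv

end PhiTilde

/-! ### Algebraicity over `ℂ(x)` and the differential equation -/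

section Main

variable {r : Fin 3 → Fin 3 → ℂ} {x₄ : ℂ} {L : PeriodPair}

/-- An elliptic function for a sublattice of the period lattice is algebraic over `ℂ(x)`. -/
lemma isAlgebraic_of_periodic (hg : GenusOne r) (hL : IsUniformization r x₄ L) (M : PeriodPair)
    (hM : M.lattice ≤ L.lattice) {f : ℂ → ℂ} (hf : Meromorphic f)
    (hper : ∀ l ∈ M.lattice, ∀ z, f (z + l) = f z) :
    IsAlgebraic (IntermediateField.adjoin ℂ {meroX r x₄ L}) (MeroField.mk f hf) := by
  obtain ⟨m, c, hc, h⟩ := exists_algebraic_relation M (meromorphic_xCov r x₄ L) hf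
    (fun l hl z ↦ xCov_add (hM hl) z) hper
  -- The relation is read as a polynomial in `f` with coefficients `p j` in `ℂ[x]`; transcendence of
  -- `x(ω)` keeps it nonzero.
  let p : Fin m → ℂ[X] := fun j ↦ ∑ i : Fin m, monomial i (c (i, j))
  let x : IntermediateField.adjoin ℂ {meroX r x₄ L} := IntermediateField.AdjoinSimple.gen ℂ _
  have hx : algebraMap _ MeroField x = meroX r x₄ L :=
    IntermediateField.AdjoinSimple.algebraMap_gen ℂ _
  refine ⟨∑ j : Fin m, monomial j (aeval x (p j)), fun h0 ↦ hc ?_, ?_⟩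
  · funext ⟨i, j⟩
    have h1 := congrArg (fun q ↦ q.coeff (j : ℕ)) h0
    simp only [finsetSum_coeff, coeff_monomial, coeff_zero, Fin.val_inj, Finset.sum_ite_eq',
      Finset.mem_univ, if_true] at h1
    have h2 : p j = 0 := by
      refine eq_zero_of_aeval_meroX hg hL ?_
      rw [← hx, aeval_algebraMap_apply, h1, map_zero]
    have h3 := congrArg (fun q ↦ q.coeff (i : ℕ)) h2
    simpa only [p, Pi.zero_apply, finsetSum_coeff, coeff_monomial, coeff_zero, Fin.val_inj, Finset.sum_ite_eq',
      Finset.sum_ite_eq, Finset.mem_univ, if_true] using h3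
  · have h1 : MeroField.mk (fun z ↦ ∑ p, c p * (xCov r x₄ L z ^ (p.1 : ℕ) * f z ^ (p.2 : ℕ)))
        (Meromorphic.fun_sum fun p _ ↦ (Meromorphic.const (c p)).mul
          ((meromorphic_xCov r x₄ L).pow.mul hf.pow)) = 0 := MeroField.mk_eq_zero.2 h
    have h2 := MeroField.mk_sum Finset.univ (f := fun (p : Fin m × Fin m) z ↦
      c p * (xCov r x₄ L z ^ (p.1 : ℕ) * f z ^ (p.2 : ℕ))) fun p ↦ (Meromorphic.const (c p)).mul
          ((meromorphic_xCov r x₄ L).pow.mul hf.pow)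
    rw [← h1, h2, Fintype.sum_prod_type_right, map_sum]
    refine Finset.sum_congr rfl fun j _ ↦ ?_
    rw [aeval_monomial, ← aeval_algebraMap_apply, hx]
    simp only [p, map_sum, aeval_monomial, Finset.sum_mul]
    refine Finset.sum_congr rfl fun i _ ↦ ?_
    rw [mul_assoc, meroX, ← MeroField.mk_pow, ← MeroField.mk_pow, ← MeroField.mk_mul,
      ← MeroField.mk_const, ← MeroField.mk_mul]
    rfl

end Main

section Main

variable {r : Fin 3 → Fin 3 → ℂ} {x₄ : ℂ} {L : PeriodPair}

/-- The product of `Φ̃` and a rational function on the curve satisfies a linear differential equation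
over `ℂ[x]`, if `ω₃` and `ω₂` are commensurable. -/
lemma exists_ode_phiTilde_mul (hg : GenusOne r) (hL : IsUniformization r x₄ L) {s : ℝ} (hs : s ≠ 0)
    {N : ℕ} {j : ℤ} (hj : N * s = j) (hj0 : j ≠ 0) (n : ℕ) (h : FunField r) :
    ∃ (m : ℕ) (c : ℕ → ℂ[X]), c m ≠ 0 ∧ ∀ᶠ ω in codiscrete ℂ, ∑ i ∈ Finset.range (m + 1),
      (c i).eval (xCov r x₄ L ω) * iteratedDerivWrt (xCov r x₄ L)
        (fun ω ↦ phiTilde L.ω₁ L.ω₂ (s * L.ω₂) ω / n * onCover x₄ L h ω) i ω = 0 := by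
  have hX := meromorphic_xCov r x₄ L
  have hΦ := meromorphic_phiTilde L hs
  have hjR : (j : ℝ) ≠ 0 := by exact_mod_cast hj0
  -- The common sublattice `ℤω₁ + ℤjω₂`: it lies in `ℤω₁ + ℤω₃` because `jω₂ = Nsω₂ = Nω₃`.
  set M := scalePeriod L j hjR with hM
  have hML : M.lattice ≤ L.lattice := by
    refine lattice_scalePeriod_le L.ω₁_mem_lattice ?_
    simpa using L.lattice.smul_mem j L.ω₂_mem_lattice
  have hMs : M.lattice ≤ (scalePeriod L s hs).lattice := by
    refine lattice_scalePeriod_le (scalePeriod L s hs).ω₁_mem_lattice ?_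
    have := (scalePeriod L s hs).lattice.smul_mem (N : ℤ) (scalePeriod L s hs).ω₂_mem_lattice
    rw [← hj]
    simpa [scalePeriod, mul_assoc] using this
  have hS : Meromorphic fun ω ↦ onCover x₄ L h ω / n :=
    (meromorphic_onCover h).div (Meromorphic.const _)
  have hSalg := isAlgebraic_of_periodic hg hL L le_rfl hS fun l hl z ↦ by
    rw [onCover_add h hl]
  have hdX : MeroField.D (meroX r x₄ L) ≠ 0 := by
    rw [meroX, MeroField.D_mk, Ne, MeroField.mk_eq_zero]
    intro h0
    obtain ⟨z, h1, h2⟩ := ((eventually_codiscrete_iff.1 h0 0).and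
      (eventually_codiscrete_iff.1 (eventually_deriv_xCov_ne_zero hg hL) 0)).exists
    exact h2 h1
  -- This is `d/dx`, normalized so that `x` has derivative `1`.
  set D' : Derivation ℂ MeroField MeroField := (MeroField.D (meroX r x₄ L))⁻¹ • MeroField.D with hD'
  have hD'x : D' (meroX r x₄ L) = 1 := by
    rw [hD', Derivation.smul_apply, smul_eq_mul, inv_mul_cancel₀ hdX]
  -- A representative of the derivative of `Φ̃` whose periodicity at every point follows from that
  -- of `℘`.
  set T : ℂ → ℂ := fun ω ↦ L.ω₁ / (2 * Complex.I * Real.pi) *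
      -(scalePeriod L s hs).weierstrassP (ω - L.ω₂ / 2) -
      1 / (Complex.I * Real.pi) * weierstrassZeta L.ω₁ (s * L.ω₂) (L.ω₁ / 2) with hT
  have hTm : Meromorphic T := hΦ.deriv.congr_codiscrete (deriv_phiTilde L hs)
  have hΦalg : IsAlgebraic (IntermediateField.adjoin ℂ {meroX r x₄ L})
      (D' (MeroField.mk _ hΦ)) := by
    have h1 : D' (MeroField.mk _ hΦ) = MeroField.mk (T / deriv (xCov r x₄ L)) (hTm.div hX.deriv) := by
      rw [hD', Derivation.smul_apply, smul_eq_mul, MeroField.D_mk,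
        (MeroField.mk_eq_mk (hf := hΦ.deriv) (hg := hTm)).2 (deriv_phiTilde L hs), meroX, MeroField.D_mk,
        MeroField.mk_div, div_eq_mul_inv, mul_comm]
    rw [h1]
    refine isAlgebraic_of_periodic hg hL M hML _ fun l hl z ↦ ?_
    have h2 : deriv (xCov r x₄ L) (z + l) = deriv (xCov r x₄ L) z := by
      rw [← deriv_comp_add_const]
      exact congrArg (fun f ↦ deriv f z) (funext fun w ↦ xCov_add (hML hl) w)
    have h3 : (scalePeriod L s hs).weierstrassP (z + l - L.ω₂ / 2) =
        (scalePeriod L s hs).weierstrassP (z - L.ω₂ / 2) := by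
      rw [add_sub_right_comm]
      exact (scalePeriod L s hs).weierstrassP_add_coe _ ⟨l, hMs hl⟩
    simp only [Pi.div_apply, hT, h2, h3]
  obtain ⟨m, c, hc, hode⟩ := exists_linear_ode D' hD'x hSalg hΦalg
  refine ⟨m, c, hc, ?_⟩
  set w : ℂ → ℂ := fun ω ↦ phiTilde L.ω₁ L.ω₂ (s * L.ω₂) ω / n * onCover x₄ L h ω with hw
  have hwm : Meromorphic w := (hΦ.div (Meromorphic.const _)).mul (meromorphic_onCover h)
  have hSΦ : MeroField.mk _ hS * MeroField.mk _ hΦ = MeroField.mk w hwm := by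
    rw [← MeroField.mk_mul, MeroField.mk_eq_mk]
    refine .of_forall fun ω ↦ ?_
    simp only [Pi.mul_apply, hw]
    ring
  rw [hSΦ] at hode
  have hterm (i : ℕ) : Meromorphic fun ω ↦
      (c i).eval (xCov r x₄ L ω) * iteratedDerivWrt (xCov r x₄ L) w i ω :=
    (MeroField.meromorphic_eval (c i) hX).mul (meromorphic_iteratedDerivWrt hX hwm i)
  refine MeroField.mk_eq_zero.1 ((MeroField.mk_sum _ hterm).trans (Eq.trans ?_ hode))
  refine Finset.sum_congr rfl fun i _ ↦ ?_
  rw [hD', meroX, ← mk_iteratedDerivWrt hX hwm, ← MeroField.mk_eval, ← MeroField.mk_mul]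
  rfl

/-- Through almost every point passes an analytic branch. -/
lemma exists_branch (hg : GenusOne r) (hL : IsUniformization r x₄ L) {w : ℂ → ℂ}
    (hw : Meromorphic w) : ∀ᶠ ω in codiscrete ℂ, ∃ φ : ℂ → ℂ,
      IsInverseBranch r x₄ L φ (xCov r x₄ L ω) ∧ φ (xCov r x₄ L ω) = ω ∧
      IsBranchOf r x₄ L w (w ∘ φ) (xCov r x₄ L ω) := by
  filter_upwards [eventually_codiscrete_analyticAt (meromorphic_xCov r x₄ L),
    eventually_codiscrete_analyticAt hw, eventually_deriv_xCov_ne_zero hg hL,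
    eventually_codiscrete_eventually_nhds (eventually_weierstrassP_eq_g hg hL)] with ω h1 h2 h3 h4
  -- The inverse function theorem applies where `x'(ω) ≠ 0`, and `℘(φ(s)) = g(x(φ(s))) = g(s)`.
  set φ := h1.hasStrictDerivAt.localInverse _ _ _ h3 with hφdef
  have hφ : AnalyticAt ℂ φ (xCov r x₄ L ω) := h1.analyticAt_localInverse h3
  have hφω : φ (xCov r x₄ L ω) = ω := HasStrictFDerivAt.localInverse_apply_image ..
  have hinv : ∀ᶠ s in 𝓝 (xCov r x₄ L ω), xCov r x₄ L (φ s) = s :=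
    HasStrictDerivAt.eventually_right_inverse ..
  have hb : IsInverseBranch r x₄ L φ (xCov r x₄ L ω) := by
    refine ⟨hφ, ?_⟩
    have ht : Tendsto φ (𝓝 (xCov r x₄ L ω)) (𝓝 ω) := by
      have := hφ.continuousAt.tendsto
      rwa [hφω] at this
    filter_upwards [hinv, ht.eventually h4] with s h5 h6
    rw [h6, h5]
  exact ⟨φ, hb, hφω, AnalyticAt.comp (by rwa [hφω]) hφ, φ, hb, rfl⟩

end Main

end QuarterPlane

end

theorem mainTheorem4
    (r : Fin 3 → Fin 3 → ℂ) [Fact (Irreducible (QuarterPlane.kernel r))]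
    (hgenus : QuarterPlane.GenusOne r)
    (ξ η : QuarterPlane.FunField r ≃ₐ[ℂ] QuarterPlane.FunField r)
    (hξ : QuarterPlane.IsXi ξ) (hη : QuarterPlane.IsEta η)
    (n : ℕ) (hn : 0 < n) (hgroup : Nat.card (QuarterPlane.walkGroup ξ η) = 2 * n)
    (q q' q₀ : QuarterPlane.FunField r) (hq : q ≠ 0) (hq' : q' ≠ 0)
    (x₄ : ℂ) (L : PeriodPair) (hL : QuarterPlane.IsUniformization r x₄ L)
    (ω₃ : ℂ) (hreal : ∃ s : ℝ, ω₃ = s * L.ω₂)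
    (hδ : QuarterPlane.IsTranslation x₄ L (η * ξ) ω₃) :
    (∀ ω : ℂ, ω ∉ L.lattice →
      ((QuarterPlane.disc r).coeff 4 ≠ 0 →
        L.weierstrassP ω ≠ (QuarterPlane.disc r).derivative.derivative.eval x₄ / 6) →
      L.weierstrassP ω = QuarterPlane.g r x₄ (QuarterPlane.xCov r x₄ L ω)) ∧
    Meromorphic (QuarterPlane.w₂ x₄ L ω₃ ξ η n q q' q₀) ∧
    (∀ᶠ ω in Filter.codiscrete ℂ, ∃ φ : ℂ → ℂ,
      QuarterPlane.IsInverseBranch r x₄ L φ (QuarterPlane.xCov r x₄ L ω) ∧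
      φ (QuarterPlane.xCov r x₄ L ω) = ω ∧
      QuarterPlane.IsBranchOf r x₄ L (QuarterPlane.w₂ x₄ L ω₃ ξ η n q q' q₀)
        (QuarterPlane.w₂ x₄ L ω₃ ξ η n q q' q₀ ∘ φ) (QuarterPlane.xCov r x₄ L ω)) ∧
    QuarterPlane.IsHolonomic (QuarterPlane.IsBranchOf r x₄ L
      (QuarterPlane.w₂ x₄ L ω₃ ξ η n q q' q₀)) := by
  open QuarterPlane in
  obtain ⟨s, rfl⟩ := hreal
  have hpow : (η * ξ) ^ (2 * n) = 1 := by
    have hmem : η * ξ ∈ walkGroup ξ η :=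
      mul_mem (Subgroup.subset_closure (by simp)) (Subgroup.subset_closure (by simp))
    have := pow_card_eq_one' (x := (⟨η * ξ, hmem⟩ : walkGroup ξ η))
    rw [hgroup] at this
    exact congrArg Subtype.val this
  -- For `s = 0` the automorphism `δ` would be the identity; as `ξ` fixes `x`, so would `η`.
  have hs : s ≠ 0 := by
    rintro rfl
    refine hη.apply_coordX_ne hgenus ?_
    have h := IsTranslation.apply_eq_self hgenus hL (by simpa using hδ) (coordX r)
    rwa [AlgEquiv.mul_apply, hξ.1] at h
  have hmem := hδ.mul_mem_lattice hgenus hL hpow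
  obtain ⟨j, hj⟩ := exists_int_of_mem_lattice (L := L) (s := (2 * n : ℕ) * s) (by
    simpa [mul_assoc] using hmem)
  have hj0 : j ≠ 0 := by
    rintro rfl
    rw [Int.cast_zero] at hj
    have h2n : ((2 * n : ℕ) : ℝ) ≠ 0 := by exact_mod_cast (by omega : 2 * n ≠ 0)
    exact mul_ne_zero h2n hs hj
  have hw : Meromorphic (w₂ x₄ L (s * L.ω₂) ξ η n q q' q₀) :=
    ((meromorphic_phiTilde L hs).div (Meromorphic.const _)).mul (meromorphic_onCover _)
  refine ⟨fun ω _ h ↦ weierstrassP_eq_g hgenus hL h, hw, exists_branch hgenus hL hw, ?_⟩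
  obtain ⟨m, c, hc, hode⟩ := exists_ode_phiTilde_mul hgenus hL hs hj hj0 n
    (orbitSum (η * ξ) n (coeffF η q q') (coeffPsi η q q' q₀))
  refine ⟨m, c, hc, ?_⟩
  rintro F t ⟨hF, φ, ⟨hφ, hbranch⟩, rfl⟩
  exact ode_of_branch (meromorphic_xCov r x₄ L) hw hφ
    (hbranch.mono fun _ h ↦ xCov_eq_of_weierstrassP_eq_g hgenus hL h) hF hode
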